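/- \textbf{Theorem.} The future TP problem with simple trigger rules and non-singular intervals is $\mathrm{EXPSPACE}$-hard under polynomial-time many-one reductions. That is, for every language $L\subseteq\{0,1\}^*$ decided by a deterministic Turing machine using at most $2^{p(n)}$ tape cells on inputs of length $n$ for some polynomial $p$, there is a polynomial-time computable function mapping each word $w$ to a domain $P_w$ of the kind described below such that $w\in L$ if and only if $P_w$ has a future plan. Here the following definitions are used. \begin{itemize} \item An interval is a nonempty interval of $\mathbb{R}_{\ge 0}$ with endpoints in $\mathbb{N}\cup\{\infty\}$; it is \emph{singular} if it has the form $[a,a]$. A \emph{state variable} is a triple $x=(V_x,T_x,D_x)$ with $V_x$ finite, $T_x:V_x\to 2^{V_x}$, and $D_x$ assigning to each value an interval. A \emph{timeline} for $x$ is a nonempty finite sequence of tokens $(v_0,d_0)\cdots(v_m,d_m)$ with $v_i\in V_x$, $d_i\in D_x(v_i)$ and $v_{i+1}\in T_x(v_i)$; its $i$-th token starts at time $\mathsf{s}=\sum_{h<i}d_h$ and ends at time $\mathsf{e}=\sum_{h\le i}d_h$. A \emph{multi-timeline} $\Pi$ of a finite set $SV$ of state variables assigns to each $x\in SV$ a timeline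 for $x$. \item Let $\Sigma$ be a countably infinite set of token names. An \emph{atom} is an interval atom $o_1\le_I^{e_1,e_2}o_2$, or a time-point atom $o_1\le_I^{e_1}n$ or $n\le_I^{e_1}o_1$, with $o_1,o_2\in\Sigma$, $e_1,e_2\in\{\mathsf{s},\mathsf{e}\}$, $n\in\mathbb{N}$ and $I$ an interval. For an assignment $\lambda$ of tokens of $\Pi$ to the names, these atoms mean, respectively, $e_2(\lambda(o_2))-e_1(\lambda(o_1))\in I$, $n-e_1(\lambda(o_1))\in I$ and $e_1(\lambda(o_1))-n\in I$. \item An \emph{existential statement} is $\exists o_1[x_1=v_1]\cdots\exists o_k[x_k=v_k].\,\mathcal{C}$ with $\mathcal{C}$ a conjunction of atoms; it holds for $\lambda$ if each $\lambda(o_i)$ is a token of the timeline of $x_i$ with value $v_i$ and $\lambda$ satisfies all atoms of $\mathcal{C}$. A \emph{trigger rule} is $o_0[x_0=v_0]\to\mathcal{E}_1\vee\cdots\vee\mathcal{E}_k$ and a \emph{trigger-less rule} is $\top\to\mathcal{E}_1\vee\cdots\vee\mathcal{E}_k$ ($k\ge 1$), where the $\mathcal{E}_i$ are existential statements with no free token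 name except possibly $o_0$ in the first case. A trigger-less rule is satisfied if some $\mathcal{E}_i$ holds for some $\lambda$. A trigger rule is satisfied \emph{under the future semantics} if for each token $\tau$ of the timeline of $x_0$ with value $v_0$ there are an $i$ and a $\lambda$ with $\lambda(o_0)=\tau$ such that $\mathcal{E}_i$ holds for $\lambda$ and no token assigned to a quantified name of $\mathcal{E}_i$ starts strictly before $\tau$. \item A \emph{TP domain} is a finite set $SV$ of state variables with a finite set of rules. A \emph{future plan} is a multi-timeline of $SV$ satisfying all trigger-less rules, and all trigger rules under the future semantics. The \emph{future TP problem} asks whether a given TP domain has a future plan. The restricted problem takes as instances the TP domains whose trigger rules are \emph{simple} (in each existential statement, each token name distinct from the trigger occurs in at most one interval atom) and in which no interval in an atom of a trigger rule is singular. Domains are given as binary words, with all numerical constants in binary. \end{itemize} -/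

import Mathlib

open scoped NNReal

/-! ## Exponential space and polynomial-time reductions -/

namespace Complexity

open Turing

/-- Displacement of the head caused by a Turing machine instruction. -/
def headShift {Γ : Type} : TM0.Stmt Γ → ℤ
  | .move .left => -1
  | .move .right => 1
  | .write _ => 0

/-- One step of a (deterministic, single-tape) Turing machine, where the configuration is paired
with the absolute position of the head on the two-way infinite tape. -/
def trackedStep {Γ Λ : Type} [Inhabited Γ] [Inhabited Λ] (M : TM0.Machine Γ Λ)
    (c : TM0.Cfg Γ Λ × ℤ) : Option (TM0.Cfg Γ Λ × ℤ) :=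
  (M c.1.q c.1.Tape.head).bind fun a =>
    (TM0.step M c.1).map fun c' => (c', c.2 + headShift a.2)

/-- A deterministic single-tape Turing machine with finitely many tape symbols and states, with
an embedding of the input alphabet `{0,1}` into the nonblank tape symbols and a set of accepting
states. The blank and the initial state are the default elements of `Γ` and `Λ`. -/
structure Decider where
  Γ : Type
  Λ : Type
  [inhΓ : Inhabited Γ]
  [inhΛ : Inhabited Λ]
  [finΓ : Finite Γ]
  [finΛ : Finite Λ]
  M : TM0.Machine Γ Λ
  inputSymbol : Bool → Γ
  inputSymbol_injective : Function.Injective inputSymbol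
  inputSymbol_ne_blank : ∀ b, inputSymbol b ≠ default
  accept : Set Λ

attribute [instance] Decider.inhΓ Decider.inhΛ Decider.finΓ Decider.finΛ

namespace Decider

/-- Initial configuration on input `w`: the head, at position `0`, is on the first letter. -/
def start (D : Decider) (w : List Bool) : TM0.Cfg D.Γ D.Λ × ℤ :=
  (TM0.init (w.map D.inputSymbol), 0)

/-- The machine halts on every input, and accepts exactly the words of `L`. -/
def Decides (D : Decider) (L : Set (List Bool)) : Prop :=
  ∀ w, ∃ c, StateTransition.Reaches (trackedStep D.M) (D.start w) c ∧
    trackedStep D.M c = none ∧ (c.1.q ∈ D.accept ↔ w ∈ L)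

/-- The set of tape cells that the head visits during the computation on input `w`. -/
def visitedCells (D : Decider) (w : List Bool) : Set ℤ :=
  {i | ∃ c, StateTransition.Reaches (trackedStep D.M) (D.start w) c ∧ c.2 = i}

end Decider

/-- The class `EXPSPACE`: languages over `{0,1}` decided by a deterministic Turing machine that
uses at most `2 ^ p(n)` tape cells on inputs of length `n`, for some polynomial `p`. -/
def EXPSPACE : Set (Set (List Bool)) :=
  {L | ∃ (D : Decider) (p : Polynomial ℕ), D.Decides L ∧
    ∀ w, (D.visitedCells w).encard ≤ ((2 ^ p.eval w.length : ℕ) : ℕ∞)}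

/-- Polynomial-time many-one reducibility of the decision problem `A` (on instances of type `α`
written as words by `encA`) to the decision problem `B`. -/
def PolyTimeReducible {α β ΓA ΓB : Type} (encA : α → List ΓA) (encB : β → List ΓB)
    (A : Set α) (B : Set β) : Prop :=
  ∃ f : α → β, Nonempty (TM2ComputableInPolyTime encA encB f) ∧ ∀ a, a ∈ A ↔ f a ∈ B

/-- The decision problem `B` is `EXPSPACE`-hard under polynomial-time reductions. -/
def EXPSPACEHard {β ΓB : Type} (encB : β → List ΓB) (B : Set β) : Prop :=
  ∀ L ∈ EXPSPACE, PolyTimeReducible (id : List Bool → List Bool) encB L B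

end Complexity

/-! ## Timeline-based planning over dense time -/

namespace TP

/-- Nonempty intervals of `ℝ₊` with endpoints in `ℕ ∪ {∞}`: `lo` is the left endpoint, and `hi` is
the right one (`none` for `∞`); the Boolean flags tell whether the endpoint belongs to the
interval. -/
structure Intv where
  lo : ℕ
  loClosed : Bool
  hi : Option (ℕ × Bool)
  nonempty : ∀ b ∈ hi, lo < b.1 ∨ (lo = b.1 ∧ loClosed = true ∧ b.2 = true)

namespace Intv

/-- The set of reals denoted by an interval. -/
def toSet (I : Intv) : Set ℝ :=
  {t | (if I.loClosed then (I.lo : ℝ) ≤ t else (I.lo : ℝ) < t) ∧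
    ∀ b ∈ I.hi, if b.2 then t ≤ (b.1 : ℝ) else t < (b.1 : ℝ)}

/-- Singular intervals, i.e. those of the form `[a, a]`. -/
def IsSingular (I : Intv) : Prop :=
  I.loClosed = true ∧ I.hi = some (I.lo, true)

/-- The interval `[0, ∞[`. -/
def nonneg : Intv := ⟨0, true, none, by simp⟩

end Intv

/-- A state variable `x = (V, T, D)`, with `V = {0, …, card - 1}`, value transition function
`T = next` and constraint function `D = dur`. -/
structure StateVar where
  card : ℕ
  next : Fin card → Finset (Fin card)
  dur : Fin card → Intv

/-- Start and end of a token. -/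
inductive Event
  | start
  | finish

/-- A timeline for the state variable `x`: a nonempty finite sequence of tokens
(value, duration). -/
structure Timeline (x : StateVar) where
  tokens : List (Fin x.card × ℝ≥0)
  nonempty : tokens ≠ []
  dur_mem : ∀ t ∈ tokens, (t.2 : ℝ) ∈ (x.dur t.1).toSet
  chain : tokens.IsChain fun t t' => t'.1 ∈ x.next t.1

/-- Start time and end time of the `i`-th token of a timeline. -/
def Timeline.time {x : StateVar} (π : Timeline x) (i : ℕ) : Event → ℝ
  | .start => (((π.tokens.take i).map Prod.snd).sum : ℝ≥0)
  | .finish => (((π.tokens.take (i + 1)).map Prod.snd).sum : ℝ≥0)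

/-- A multi-timeline of a finite family of state variables. -/
abbrev MultiTimeline {n : ℕ} (SV : Fin n → StateVar) : Type :=
  (x : Fin n) → Timeline (SV x)

/-- Atoms; token names are natural numbers.
* `interval o₁ e₁ I e₂ o₂` is `o₁ ≤_I^{e₁,e₂} o₂`;
* `le o e I n` is `o ≤_I^e n`;
* `ge n e I o` is `n ≤_I^e o`. -/
inductive Atom
  | interval (o₁ : ℕ) (e₁ : Event) (I : Intv) (e₂ : Event) (o₂ : ℕ)
  | le (o : ℕ) (e : Event) (I : Intv) (n : ℕ)
  | ge (n : ℕ) (e : Event) (I : Intv) (o : ℕ)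

namespace Atom

/-- The interval of an atom. -/
def intv : Atom → Intv
  | interval _ _ I _ _ => I
  | le _ _ I _ => I
  | ge _ _ I _ => I

/-- The token names that occur in an atom. -/
def names : Atom → List ℕ
  | interval o₁ _ _ _ o₂ => [o₁, o₂]
  | le o _ _ _ => [o]
  | ge _ _ _ o => [o]

/-- The atom is an interval atom in which the token name `o` occurs. -/
def isIntervalAtomOf (o : ℕ) : Atom → Bool
  | interval o₁ _ _ _ o₂ => o₁ = o ∨ o₂ = o
  | le _ _ _ _ => false
  | ge _ _ _ _ => false

end Atom

section Statements

variable {n : ℕ} (SV : Fin n → StateVar)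

/-- A quantifier `name[var = value]`. -/
structure Quantifier where
  name : ℕ
  var : Fin n
  value : Fin (SV var).card

/-- An existential statement: quantifiers, and a conjunction of atoms. -/
structure ExStatement where
  quantifiers : List (Quantifier SV)
  atoms : List Atom

end Statements

section Rules

variable {n : ℕ} {SV : Fin n → StateVar}

/-- The token name `o` occurs free in the existential statement. -/
def ExStatement.IsFree (E : ExStatement SV) (o : ℕ) : Prop :=
  (∃ a ∈ E.atoms, o ∈ a.names) ∧ ∀ q ∈ E.quantifiers, q.name ≠ o

variable (SV) in
/-- A trigger rule `o₀[x₀ = v₀] → E₁ ∨ … ∨ E_k`. -/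
structure TriggerRule where
  trigger : Quantifier SV
  disjuncts : List (ExStatement SV)
  nonempty : disjuncts ≠ []
  closed : ∀ E ∈ disjuncts, ∀ o, E.IsFree o → o = trigger.name

variable (SV) in
/-- A trigger-less rule `⊤ → E₁ ∨ … ∨ E_k`. -/
structure TriggerlessRule where
  disjuncts : List (ExStatement SV)
  nonempty : disjuncts ≠ []
  closed : ∀ E ∈ disjuncts, ∀ o, ¬ E.IsFree o

/-- A trigger rule is simple if, in each of its existential statements, each token name distinct
from the trigger occurs in at most one interval atom. -/
def TriggerRule.IsSimple (R : TriggerRule SV) : Prop :=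
  ∀ E ∈ R.disjuncts, ∀ o, o ≠ R.trigger.name → E.atoms.countP (Atom.isIntervalAtomOf o) ≤ 1

/-- No interval in the atoms of the trigger rule is singular. -/
def TriggerRule.NonSingular (R : TriggerRule SV) : Prop :=
  ∀ E ∈ R.disjuncts, ∀ a ∈ E.atoms, ¬ a.intv.IsSingular

/-- `∃ o₁[x₁ = v₁] ⋯ ∃ o_n[x_n = v_n]. C ∧ ⋀ᵢ o₀ ≤_{[0,∞[}^{s,s} oᵢ` -/
def ExStatement.future (E : ExStatement SV) (o₀ : ℕ) : ExStatement SV where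
  quantifiers := E.quantifiers
  atoms := E.atoms ++ E.quantifiers.map fun q => .interval o₀ .start .nonneg .start q.name

/-- The trigger rule obtained by requiring, in each existential statement, that no quantified token
starts strictly before the trigger. -/
def TriggerRule.future (R : TriggerRule SV) : TriggerRule SV where
  trigger := R.trigger
  disjuncts := R.disjuncts.map fun E => E.future R.trigger.name
  nonempty := by simpa using R.nonempty
  closed := by
    intro E' hE' o ho
    obtain ⟨E, hE, rfl⟩ := List.mem_map.1 hE'
    obtain ⟨⟨a, ha, hoa⟩, hq⟩ := ho
    rcases List.mem_append.1 ha with ha | ha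
    · exact R.closed E hE o ⟨⟨a, ha, hoa⟩, hq⟩
    · obtain ⟨q, hqE, rfl⟩ := List.mem_map.1 ha
      simp only [Atom.names, List.mem_cons, List.not_mem_nil, or_false] at hoa
      rcases hoa with h | h
      · exact h
      · exact absurd h.symm (hq q hqE)

/-- An assignment of tokens of the multi-timeline `Π` to the token names; a token is given by the
state variable whose timeline it belongs to and by its position. -/
abbrev Assignment (Pi : MultiTimeline SV) : Type :=
  ℕ → (x : Fin n) × Fin (Pi x).tokens.length

/-- The start or end time of the token named `o`. -/
def Assignment.time {Pi : MultiTimeline SV} (l : Assignment Pi) (o : ℕ) (e : Event) : ℝ :=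
  (Pi (l o).1).time (l o).2 e

/-- Satisfaction of an atom by an assignment. -/
def Atom.Sat {Pi : MultiTimeline SV} (l : Assignment Pi) : Atom → Prop
  | .interval o₁ e₁ I e₂ o₂ => l.time o₂ e₂ - l.time o₁ e₁ ∈ I.toSet
  | .le o e I m => (m : ℝ) - l.time o e ∈ I.toSet
  | .ge m e I o => l.time o e - (m : ℝ) ∈ I.toSet

/-- The assignment is consistent with the quantifiers of the existential statement. -/
def ExStatement.Consistent (E : ExStatement SV) {Pi : MultiTimeline SV} (l : Assignment Pi) :
    Prop :=
  ∀ q ∈ E.quantifiers, ∃ h : Fin (Pi q.var).tokens.length,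
    l q.name = ⟨q.var, h⟩ ∧ ((Pi q.var).tokens.get h).1 = q.value

/-- Satisfaction of a trigger-less rule. -/
def TriggerlessRule.Sat (R : TriggerlessRule SV) (Pi : MultiTimeline SV) : Prop :=
  ∃ E ∈ R.disjuncts, ∃ l : Assignment Pi, E.Consistent l ∧ ∀ a ∈ E.atoms, a.Sat l

/-- Satisfaction of a trigger rule (under the unrestricted semantics). -/
def TriggerRule.Sat (R : TriggerRule SV) (Pi : MultiTimeline SV) : Prop :=
  ∀ i : Fin (Pi R.trigger.var).tokens.length,
    ((Pi R.trigger.var).tokens.get i).1 = R.trigger.value →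
    ∃ E ∈ R.disjuncts, ∃ l : Assignment Pi, E.Consistent l ∧
      l R.trigger.name = ⟨R.trigger.var, i⟩ ∧ ∀ a ∈ E.atoms, a.Sat l

/-- Satisfaction of a trigger rule under the future semantics. -/
def TriggerRule.FutureSat (R : TriggerRule SV) (Pi : MultiTimeline SV) : Prop :=
  R.future.Sat Pi

end Rules

/-- A TP domain `P = (SV, R)`; the finite set `R` of synchronization rules is listed as trigger
rules and trigger-less rules. -/
structure Domain where
  n : ℕ
  SV : Fin n → StateVar
  triggerRules : List (TriggerRule SV)
  triggerlessRules : List (TriggerlessRule SV)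

namespace Domain

/-- A future plan of `P`. -/
def IsFuturePlan (P : Domain) (Pi : MultiTimeline P.SV) : Prop :=
  (∀ R ∈ P.triggerRules, R.FutureSat Pi) ∧ ∀ R ∈ P.triggerlessRules, R.Sat Pi

/-- Domains whose trigger rules are simple and whose intervals in the atoms of the trigger rules
are non-singular. -/
def SimpleNonSingular (P : Domain) : Prop :=
  ∀ R ∈ P.triggerRules, R.IsSimple ∧ R.NonSingular

end Domain

/-! ### Encoding of TP domains as binary words

All natural numbers, in particular the constants in intervals and atoms, are in binary. -/

/-- The binary digits `b₀ b₁ … b_k` of `m` (least significant first) are written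
`1 b₀ 1 b₁ … 1 b_k 0`. -/
def encNat (m : ℕ) : List Bool :=
  (m.bits.flatMap fun b => [true, b]) ++ [false]

/-- A list `a₁ … a_k` is written `1 a₁ … 1 a_k 0`. -/
def encList {α : Type} (f : α → List Bool) (l : List α) : List Bool :=
  (l.flatMap fun a => true :: f a) ++ [false]

def Intv.encode (I : Intv) : List Bool :=
  encNat I.lo ++ I.loClosed :: match I.hi with
    | none => [false]
    | some (b, c) => true :: (encNat b ++ [c])

def Event.encode : Event → List Bool
  | .start => [false]
  | .finish => [true]

def Atom.encode : Atom → List Bool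
  | .interval o₁ e₁ I e₂ o₂ =>
      true :: (encNat o₁ ++ (e₁.encode ++ (I.encode ++ (e₂.encode ++ encNat o₂))))
  | .le o e I m => false :: true :: (encNat o ++ (e.encode ++ (I.encode ++ encNat m)))
  | .ge m e I o => false :: false :: (encNat m ++ (e.encode ++ (I.encode ++ encNat o)))

/-- A state variable is written as the list, over its values `v`, of the list of the values in
`T(v)` followed by the interval `D(v)`. -/
def StateVar.encode (x : StateVar) : List Bool :=
  encList (fun p : List ℕ × Intv => encList encNat p.1 ++ p.2.encode)
    (List.ofFn fun v => (((x.next v).sort (· ≤ ·)).map Fin.val, x.dur v))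

section EncodeRules

variable {n : ℕ} {SV : Fin n → StateVar}

def Quantifier.encode (q : Quantifier SV) : List Bool :=
  encNat q.name ++ (encNat q.var ++ encNat q.value)

def ExStatement.encode (E : ExStatement SV) : List Bool :=
  encList Quantifier.encode E.quantifiers ++ encList Atom.encode E.atoms

def TriggerRule.encode (R : TriggerRule SV) : List Bool :=
  R.trigger.encode ++ encList ExStatement.encode R.disjuncts

def TriggerlessRule.encode (R : TriggerlessRule SV) : List Bool :=
  encList ExStatement.encode R.disjuncts

end EncodeRules

/-- The binary word that represents a TP domain. -/
def Domain.encode (P : Domain) : List Bool :=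
  encList StateVar.encode (List.ofFn P.SV) ++
    (encList TriggerRule.encode P.triggerRules ++
      encList TriggerlessRule.encode P.triggerlessRules)

/-- `f` is injective, and no code word is a proper prefix of another one. -/
def PrefixCode {α : Type} (f : α → List Bool) : Prop :=
  ∀ a b s t, f a ++ s = f b ++ t → a = b ∧ s = t

theorem PrefixCode.encList {α : Type} {f : α → List Bool} (hf : PrefixCode f) :
    PrefixCode (encList f) := by
  intro a
  induction a with
  | nil => intro b s t h; cases b <;> simp_all [TP.encList]
  | cons x a ih =>
    intro b s t h
    cases b with
    | nil => simp [TP.encList] at h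
    | cons y b =>
      simp only [TP.encList, List.flatMap_cons, List.cons_append, List.append_assoc,
        List.cons.injEq, true_and] at h
      obtain ⟨rfl, h⟩ := hf _ _ _ _ h
      obtain ⟨rfl, rfl⟩ := ih b s t (by simpa [TP.encList] using h)
      exact ⟨rfl, rfl⟩

theorem prefixCode_encNat : PrefixCode encNat := by
  intro a b s t h
  have hb : PrefixCode fun c : Bool => [c] := by
    intro a b s t h; simpa using h
  obtain ⟨h1, h2⟩ := hb.encList a.bits b.bits s t h
  refine ⟨Nat.eq_of_testBit_eq fun i => ?_, h2⟩
  rw [Nat.testBit_eq_inth, Nat.testBit_eq_inth, h1]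

theorem prefixCode_intv : PrefixCode Intv.encode := by
  rintro ⟨a, c, u, ha⟩ ⟨b, d, v, hb⟩ s t h
  simp only [Intv.encode, List.append_assoc, List.cons_append] at h
  replace h := prefixCode_encNat _ _ _ _ h
  obtain ⟨rfl, h⟩ := h
  simp only [List.cons.injEq] at h
  obtain ⟨rfl, h⟩ := h
  rcases u with _ | ⟨u, u'⟩ <;> rcases v with _ | ⟨v, v'⟩
  · simpa using h
  · simp at h
  · simp at h
  · simp only [List.cons.injEq, true_and, List.append_assoc, List.cons_append] at h
    replace h := prefixCode_encNat _ _ _ _ h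
    obtain ⟨rfl, h⟩ := h
    simp only [List.nil_append, List.cons.injEq] at h
    obtain ⟨rfl, rfl⟩ := h
    exact ⟨rfl, rfl⟩

theorem prefixCode_event : PrefixCode Event.encode := by
  rintro (_ | _) (_ | _) s t h <;> simp_all [Event.encode]

theorem prefixCode_atom : PrefixCode Atom.encode := by
  rintro (⟨o₁, e₁, I, e₂, o₂⟩ | ⟨o, e, I, m⟩ | ⟨m, e, I, o⟩)
    (⟨o₁', e₁', I', e₂', o₂'⟩ | ⟨o', e', I', m'⟩ | ⟨m', e', I', o'⟩) s t h <;>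
  simp only [Atom.encode, List.cons_append, List.append_assoc, List.cons.injEq, true_and,
    false_and, reduceCtorEq] at h
  all_goals
    replace h := prefixCode_encNat _ _ _ _ h
    obtain ⟨rfl, h⟩ := h
    replace h := prefixCode_event _ _ _ _ h
    obtain ⟨rfl, h⟩ := h
    replace h := prefixCode_intv _ _ _ _ h
    obtain ⟨rfl, h⟩ := h
  · replace h := prefixCode_event _ _ _ _ h
    obtain ⟨rfl, h⟩ := h
    replace h := prefixCode_encNat _ _ _ _ h
    obtain ⟨rfl, rfl⟩ := h
    exact ⟨rfl, rfl⟩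
  all_goals
    replace h := prefixCode_encNat _ _ _ _ h
    obtain ⟨rfl, rfl⟩ := h
    exact ⟨rfl, rfl⟩

theorem prefixCode_stateVar : PrefixCode StateVar.encode := by
  rintro ⟨k, T, D⟩ ⟨k', T', D'⟩ s t h
  have hp : PrefixCode fun p : List ℕ × Intv => encList encNat p.1 ++ p.2.encode := by
    rintro ⟨a, I⟩ ⟨b, J⟩ s t h
    simp only [List.append_assoc] at h
    replace h := prefixCode_encNat.encList _ _ _ _ h
    obtain ⟨rfl, h⟩ := h
    replace h := prefixCode_intv _ _ _ _ h
    obtain ⟨rfl, rfl⟩ := h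
    exact ⟨rfl, rfl⟩
  obtain ⟨h1, rfl⟩ := hp.encList _ _ _ _ h
  have hk : k = k' := by simpa using congrArg List.length h1
  subst hk
  have h2 := List.ofFn_injective h1
  have hT : T = T' := by
    funext v
    have h3 := congrArg Prod.fst (congrFun h2 v)
    have h4 := List.map_injective_iff.2 Fin.val_injective h3
    rw [← Finset.sort_toFinset (T v) (· ≤ ·), h4, Finset.sort_toFinset]
  have hD : D = D' := funext fun v => congrArg Prod.snd (congrFun h2 v)
  subst hT hD
  exact ⟨rfl, rfl⟩

section EncodeRules

variable {n : ℕ} {SV : Fin n → StateVar}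

theorem prefixCode_quantifier : PrefixCode (Quantifier.encode (SV := SV)) := by
  rintro ⟨a, ⟨x, hx⟩, ⟨v, hv⟩⟩ ⟨b, ⟨y, hy⟩, ⟨w, hw⟩⟩ s t h
  simp only [Quantifier.encode, List.append_assoc] at h
  replace h := prefixCode_encNat _ _ _ _ h
  obtain ⟨rfl, h⟩ := h
  replace h := prefixCode_encNat _ _ _ _ h
  obtain ⟨rfl, h⟩ := h
  replace h := prefixCode_encNat _ _ _ _ h
  obtain ⟨rfl, rfl⟩ := h
  exact ⟨rfl, rfl⟩

theorem prefixCode_exStatement : PrefixCode (ExStatement.encode (SV := SV)) := by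
  rintro ⟨q, a⟩ ⟨q', a'⟩ s t h
  simp only [ExStatement.encode, List.append_assoc] at h
  replace h := prefixCode_quantifier.encList _ _ _ _ h
  obtain ⟨rfl, h⟩ := h
  replace h := prefixCode_atom.encList _ _ _ _ h
  obtain ⟨rfl, rfl⟩ := h
  exact ⟨rfl, rfl⟩

theorem prefixCode_triggerRule : PrefixCode (TriggerRule.encode (SV := SV)) := by
  rintro ⟨q, E, h1, h2⟩ ⟨q', E', h1', h2'⟩ s t h
  simp only [TriggerRule.encode, List.append_assoc] at h
  replace h := prefixCode_quantifier _ _ _ _ h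
  obtain ⟨rfl, h⟩ := h
  replace h := prefixCode_exStatement.encList _ _ _ _ h
  obtain ⟨rfl, rfl⟩ := h
  exact ⟨rfl, rfl⟩

theorem prefixCode_triggerlessRule : PrefixCode (TriggerlessRule.encode (SV := SV)) := by
  rintro ⟨E, h1, h2⟩ ⟨E', h1', h2'⟩ s t h
  replace h := prefixCode_exStatement.encList _ _ _ _ h
  obtain ⟨rfl, rfl⟩ := h
  exact ⟨rfl, rfl⟩

end EncodeRules

/-- Distinct domains are represented by distinct words. -/
theorem Domain.encode_injective : Function.Injective Domain.encode := by
  rintro ⟨n, SV, R, Q⟩ ⟨n', SV', R', Q'⟩ h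
  simp only [Domain.encode] at h
  obtain ⟨h1, h⟩ := prefixCode_stateVar.encList _ _ _ _ h
  have hn : n = n' := by simpa using congrArg List.length h1
  subst hn
  have h2 := List.ofFn_injective h1
  subst h2
  replace h := prefixCode_triggerRule.encList _ _ _ _ h
  obtain ⟨rfl, h⟩ := h
  obtain ⟨rfl, _⟩ := prefixCode_triggerlessRule.encList Q Q' [] [] (by simpa using h)
  rfl

end TP

/-! ## Stack programs -/

namespace StackProg

open Turing Function

/-! The reduction writes the computation of a space-bounded machine along one timeline whose tokens
all last exactly one time unit. Token `t` then starts at time `t`, every difference of start times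
is an integer, and the non-singular interval `]k, k + 1]` forces the exact distance `k + 1`. Unit
durations thus restore the exact distances that trigger rules may not state directly; the singular
interval used to impose them sits in the state variable, where it is allowed.

Fix an exponentially large `R`. The timeline holds a mark at time 0, the input followed by blanks up
to time `R`, and then successive configurations in rows of length `R`. The new content of a cell
depends only on that cell and its two neighbours (`cellAt_totalStep`). So one trigger rule per value
`v` suffices: it guesses the next two values `b`, `c` and demands the updated middle cell `R + 1`
units after the trigger. All three requirements start at the trigger, so the rule is simple, and all
lie in its future. A second alternative releases the demand near the end. The end token may only
follow a halted accepting cell.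

Consecutive rows touch, so the two edges of a row see cells of neighbouring rows instead of their
true neighbours. This is harmless because the head stays strictly within distance `S` of the origin
(`abs_conf_snd_lt`) and rows have more than `2 * S` cells: no head is ever at an edge. Hence the
sequence `trace` obeys the step rule (`trace_step`), and conversely every tiling follows it up to
the end token (`IsTiling.eq_trace`). Reaching the end is therefore the same as acceptance
(`exists_tiling_iff`), and tilings are the same as future plans (`exists_plan_iff`).

For the running time, `R = 2 ^ M(n) - 1` is chosen because `R` and `R + 1` have trivial binary
expansions: they are written by copying a fixed word `M(n)` times. A small language of stack
programs, compiled to `TM2` machines (`Run.sound`), outputs the encoded domain from a unary copy of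
`M(n)` (`emits_domain`, `Emits.polyTime`). -/

/-- The stacks of a stack program. -/
inductive Stack
  | inp | out | arg | big | cnt | tmp
  deriving DecidableEq

instance : Finite Stack :=
  Finite.of_surjective
    (fun i : Fin 6 => match i with
      | 0 => Stack.inp | 1 => Stack.out | 2 => Stack.arg
      | 3 => Stack.big | 4 => Stack.cnt | 5 => Stack.tmp)
    (by intro s; cases s; exacts [⟨0, rfl⟩, ⟨1, rfl⟩, ⟨2, rfl⟩, ⟨3, rfl⟩, ⟨4, rfl⟩, ⟨5, rfl⟩])

/-- Contents of the stacks, the top of each stack being the head of the list. -/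
abbrev Store : Type := Stack → List Bool

/-- Structured programs on stacks of bits. `loop k p q` pops the stack `k` until it is empty, and
runs `p` or `q` after each pop, according to the bit that was popped. -/
inductive Prog
  | skip
  | push (k : Stack) (b : Bool)
  | seq (p q : Prog)
  | loop (k : Stack) (p q : Prog)

/-- `Run p S S' t`: started on `S`, the program `p` ends on `S'` after `t` steps. -/
inductive Run : Prog → Store → Store → ℕ → Prop
  | skip (S) : Run .skip S S 1
  | push (k b S) : Run (.push k b) S (update S k (b :: S k)) 1
  | seq {p q S₁ S₂ S₃ t₁ t₂} : Run p S₁ S₂ t₁ → Run q S₂ S₃ t₂ → Run (.seq p q) S₁ S₃ (t₁ + t₂)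
  | loopNil {k p q S} : S k = [] → Run (.loop k p q) S S 1
  | loopFalse {k p q S₁ S₂ S₃ l t₁ t₂} : S₁ k = false :: l → Run p (update S₁ k l) S₂ t₁ →
      Run (.loop k p q) S₂ S₃ t₂ → Run (.loop k p q) S₁ S₃ (1 + t₁ + t₂)
  | loopTrue {k p q S₁ S₂ S₃ l t₁ t₂} : S₁ k = true :: l → Run q (update S₁ k l) S₂ t₁ →
      Run (.loop k p q) S₂ S₃ t₂ → Run (.loop k p q) S₁ S₃ (1 + t₁ + t₂)

/-! ### Compilation of structured programs to stack machines -/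

namespace Prog

/-- The control points of a program. -/
def Point : Prog → Type
  | skip => Unit
  | push _ _ => Unit
  | seq p q => p.Point ⊕ q.Point
  | loop _ p q => Option (p.Point ⊕ q.Point)

theorem finite_point : ∀ p : Prog, Finite p.Point
  | skip => inferInstanceAs (Finite Unit)
  | push _ _ => inferInstanceAs (Finite Unit)
  | seq p q =>
    have := finite_point p
    have := finite_point q
    inferInstanceAs (Finite (p.Point ⊕ q.Point))
  | loop _ p q =>
    have := finite_point p
    have := finite_point q
    inferInstanceAs (Finite (Option (p.Point ⊕ q.Point)))

/-- The initial control point. -/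
def entry : (p : Prog) → p.Point
  | skip => ()
  | push _ _ => ()
  | seq p _ => Sum.inl p.entry
  | loop _ _ _ => none

/-- The statement of a stack machine at a control point, when control points are named through `e`
and `exit` is the label reached at the end of the program. -/
def code {Λ : Type} : (p : Prog) → (p.Point → Λ) → Λ → p.Point →
    TM2.Stmt (fun _ : Stack => Bool) Λ (Option Bool)
  | skip, _, exit, _ => .goto fun _ => exit
  | push k b, _, exit, _ => .push k (fun _ => b) (.goto fun _ => exit)
  | seq p q, e, exit, x => match x with
    | Sum.inl x => code p (fun y => e (Sum.inl y)) (e (Sum.inr q.entry)) x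
    | Sum.inr x => code q (fun y => e (Sum.inr y)) exit x
  | loop k p q, e, exit, x => match x with
    | none => .pop k (fun _ o => o) (.goto fun o => match o with
      | none => exit
      | some false => e (some (Sum.inl p.entry))
      | some true => e (some (Sum.inr q.entry)))
    | some (Sum.inl x) => code p (fun y => e (some (Sum.inl y))) (e none) x
    | some (Sum.inr x) => code q (fun y => e (some (Sum.inr y))) (e none) x

end Prog

theorem iterate_trans {α : Type} {f : α → α} {a b c : α} {s t : ℕ} (h₁ : f^[s] a = b)
    (h₂ : f^[t] b = c) : f^[s + t] a = c := by
  rw [Nat.add_comm, iterate_add_apply, h₁, h₂]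

/-- Induction on the run. Quantifying over every machine `M` that contains the code of `p` under a
naming `e` of its control points lets the hypothesis apply to subprograms embedded in larger ones.
The step count is exact: a skip, a push and a loop test cost one machine step each, while sequencing
is free because the first program exits straight to the entry of the second. -/
theorem Run.sound {p : Prog} {S S' : Store} {t : ℕ} (h : Run p S S' t) :
    ∀ {Λ : Type} (M : Λ → TM2.Stmt (fun _ : Stack => Bool) Λ (Option Bool)) (e : p.Point → Λ)
      (exit : Λ), (∀ x, M (e x) = p.code e exit x) → ∀ v, ∃ v',
      (flip bind (TM2.step M))^[t] (some ⟨some (e p.entry), v, S⟩) =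
        some ⟨some exit, v', S'⟩ := by
  induction h with
  | skip S =>
    intro Λ M e exit hM v
    refine ⟨v, ?_⟩
    simp [flip, TM2.step, hM, Prog.code]
  | push k b S =>
    intro Λ M e exit hM v
    refine ⟨v, ?_⟩
    simp [flip, TM2.step, hM, Prog.code]
  | seq _ _ ih₁ ih₂ =>
    intro Λ M e exit hM v
    obtain ⟨v₁, h₁⟩ := ih₁ M (fun y => e (Sum.inl y)) _ (fun x => hM (Sum.inl x)) v
    obtain ⟨v₂, h₂⟩ := ih₂ M (fun y => e (Sum.inr y)) _ (fun x => hM (Sum.inr x)) v₁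
    exact ⟨v₂, iterate_trans h₁ h₂⟩
  | @loopNil k p q S hk =>
    intro Λ M e exit hM v
    refine ⟨none, ?_⟩
    have h := hM none
    simp only [iterate_one, flip, TM2.step, Prog.entry, Option.bind_eq_bind, Option.bind_some, h]
    have h' : update S k [] = S := by rw [← hk, update_eq_self]
    simp [Prog.code, hk, h']
  | @loopFalse k p q S₁ S₂ S₃ l t₁ t₂ hk _ _ ih₁ ih₂ =>
    intro Λ M e exit hM v
    obtain ⟨v₁, h₁⟩ := ih₁ M (fun y => e (some (Sum.inl y))) _
      (fun x => hM (some (Sum.inl x))) (some false)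
    obtain ⟨v₂, h₂⟩ := ih₂ M e _ hM v₁
    refine ⟨v₂, iterate_trans (iterate_trans ?_ h₁) h₂⟩
    have h := hM none
    simp only [iterate_one, flip, TM2.step, Prog.entry, Option.bind_eq_bind, Option.bind_some, h]
    simp [Prog.code, hk]
  | @loopTrue k p q S₁ S₂ S₃ l t₁ t₂ hk _ _ ih₁ ih₂ =>
    intro Λ M e exit hM v
    obtain ⟨v₁, h₁⟩ := ih₁ M (fun y => e (some (Sum.inr y))) _
      (fun x => hM (some (Sum.inr x))) (some true)
    obtain ⟨v₂, h₂⟩ := ih₂ M e _ hM v₁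
    refine ⟨v₂, iterate_trans (iterate_trans ?_ h₁) h₂⟩
    have h := hM none
    simp only [iterate_one, flip, TM2.step, Prog.entry, Option.bind_eq_bind, Option.bind_some, h]
    simp [Prog.code, hk]

/-! ### Time-bounded runs and elementary programs -/

/-- The program `p` leads from `S` to `S'` in at most `t` steps. -/
def RunWithin (p : Prog) (S S' : Store) (t : ℕ) : Prop := ∃ s ≤ t, Run p S S' s

namespace RunWithin

variable {p q : Prog} {S S₁ S₂ S₃ : Store} {k : Stack} {t t₁ t₂ : ℕ}

theorem mono (h : RunWithin p S S₁ t₁) (ht : t₁ ≤ t₂) : RunWithin p S S₁ t₂ :=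
  h.imp fun _ hs => ⟨hs.1.trans ht, hs.2⟩

theorem skip : RunWithin .skip S S 1 := ⟨1, le_rfl, .skip S⟩

theorem push (b : Bool) : RunWithin (.push k b) S (update S k (b :: S k)) 1 :=
  ⟨1, le_rfl, .push k b S⟩

theorem seq : RunWithin p S₁ S₂ t₁ → RunWithin q S₂ S₃ t₂ →
    RunWithin (.seq p q) S₁ S₃ (t₁ + t₂) :=
  fun ⟨_, h₁, h₁'⟩ ⟨_, h₂, h₂'⟩ => ⟨_, Nat.add_le_add h₁ h₂, h₁'.seq h₂'⟩

theorem loopNil (h : S k = []) : RunWithin (.loop k p q) S S 1 := ⟨1, le_rfl, .loopNil h⟩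

theorem loopCons {b : Bool} {l : List Bool} (h : S₁ k = b :: l)
    (h₁ : RunWithin (if b then q else p) (update S₁ k l) S₂ t₁)
    (h₂ : RunWithin (.loop k p q) S₂ S₃ t₂) :
    RunWithin (.loop k p q) S₁ S₃ (1 + t₁ + t₂) := by
  obtain ⟨s₁, h₁, h₁'⟩ := h₁
  obtain ⟨s₂, h₂, h₂'⟩ := h₂
  refine ⟨1 + s₁ + s₂, by omega, ?_⟩
  cases b
  · exact .loopFalse h h₁' h₂'
  · exact .loopTrue h h₁' h₂'

end RunWithin

/-- The store with the given stacks. -/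
def st (inp out arg big cnt tmp : List Bool) : Store
  | .inp => inp
  | .out => out
  | .arg => arg
  | .big => big
  | .cnt => cnt
  | .tmp => tmp

section Update

variable (inp out arg big cnt tmp l : List Bool)

@[simp] theorem st_inp : st inp out arg big cnt tmp .inp = inp := rfl
@[simp] theorem st_out : st inp out arg big cnt tmp .out = out := rfl
@[simp] theorem st_arg : st inp out arg big cnt tmp .arg = arg := rfl
@[simp] theorem st_big : st inp out arg big cnt tmp .big = big := rfl
@[simp] theorem st_cnt : st inp out arg big cnt tmp .cnt = cnt := rfl
@[simp] theorem st_tmp : st inp out arg big cnt tmp .tmp = tmp := rfl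

@[simp] theorem update_inp :
    update (st inp out arg big cnt tmp) .inp l = st l out arg big cnt tmp := by
  funext k; cases k <;> rfl
@[simp] theorem update_out :
    update (st inp out arg big cnt tmp) .out l = st inp l arg big cnt tmp := by
  funext k; cases k <;> rfl
@[simp] theorem update_arg :
    update (st inp out arg big cnt tmp) .arg l = st inp out l big cnt tmp := by
  funext k; cases k <;> rfl
@[simp] theorem update_big :
    update (st inp out arg big cnt tmp) .big l = st inp out arg l cnt tmp := by
  funext k; cases k <;> rfl
@[simp] theorem update_cnt :
    update (st inp out arg big cnt tmp) .cnt l = st inp out arg big l tmp := by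
  funext k; cases k <;> rfl
@[simp] theorem update_tmp :
    update (st inp out arg big cnt tmp) .tmp l = st inp out arg big cnt l := by
  funext k; cases k <;> rfl

end Update

/-- The program that moves the contents of the stack `k`, in reverse order, onto `k'`. -/
def move (k k' : Stack) : Prog := .loop k (.push k' false) (.push k' true)

theorem run_move {k k' : Stack} (hk : k ≠ k') (l : List Bool) : ∀ S : Store, S k = l →
    RunWithin (move k k') S (update (update S k []) k' (l.reverse ++ S k'))
      (2 * l.length + 1) := by
  induction l with
  | nil =>
    intro S hS
    have h : update (update S k []) k' (([] : List Bool).reverse ++ S k') = S := by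
      funext j
      by_cases hj' : j = k'
      · simp [hj']
      · by_cases hj : j = k
        · subst hj; simp [hj', hS]
        · simp [hj', hj]
    rw [h]
    exact RunWithin.loopNil hS
  | cons b l ih =>
    intro S hS
    have h₁ : RunWithin (if b then .push k' true else .push k' false) (update S k l)
        (update (update S k l) k' (b :: S k')) 1 := by
      have := RunWithin.push (S := update S k l) (k := k') b
      rw [update_of_ne hk.symm] at this
      cases b <;> exact this
    have h₂ := ih (update (update S k l) k' (b :: S k')) (by simp [hk])
    refine (RunWithin.loopCons hS h₁ (S₃ := update (update S k []) k' ((b :: l).reverse ++ S k'))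
      ?_).mono (t₁ := 1 + 1 + (2 * l.length + 1)) (by simp; omega)
    change RunWithin (move k k') _ _ _
    convert h₂ using 1
    funext j
    by_cases hj' : j = k'
    · simp [hj']
    · by_cases hj : j = k
      · subst hj; simp [hj']
      · simp [hj', hj]

/-- The program that empties the stack `k`. -/
def clear (k : Stack) : Prog := .loop k .skip .skip

theorem run_clear {k : Stack} (l : List Bool) : ∀ S : Store, S k = l →
    RunWithin (clear k) S (update S k []) (2 * l.length + 1) := by
  induction l with
  | nil =>
    intro S hS
    rw [show update S k [] = S by rw [← hS, update_eq_self]]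
    exact RunWithin.loopNil hS
  | cons b l ih =>
    intro S hS
    have h₂ := ih (update S k l) (by simp)
    rw [update_idem] at h₂
    refine (RunWithin.loopCons hS (t₁ := 1) ?_ h₂).mono (by simp; omega)
    rw [ite_self]
    exact RunWithin.skip

/-- The program that pushes the word `l` onto the stack `k`, so that its first letter is on top. -/
def pushes (k : Stack) : List Bool → Prog
  | [] => .skip
  | b :: l => .seq (pushes k l) (.push k b)

theorem run_pushes (k : Stack) (l : List Bool) (S : Store) :
    RunWithin (pushes k l) S (update S k (l ++ S k)) (l.length + 1) := by
  induction l with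
  | nil =>
    rw [List.nil_append, update_eq_self]
    exact RunWithin.skip
  | cons b l ih =>
    have h := ih.seq (RunWithin.push (k := k) b)
    simpa [pushes] using h

/-- The program that pushes `l` onto the output for each letter of the stack `k`. -/
def emitEach (k : Stack) (l : List Bool) : Prog :=
  .seq (.loop k .skip (.seq (pushes .out l) (.push .tmp true))) (move .tmp k)

/-- The word `l` repeated `j` times. -/
def rep (l : List Bool) (j : ℕ) : List Bool := (List.replicate j l).flatten

theorem rep_succ' (l : List Bool) (j : ℕ) : rep l (j + 1) = rep l j ++ l := by
  simp [rep, List.replicate_succ']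

/-- Each letter popped from the counter is saved on `tmp`, so that the counter can be restored
afterwards by `move`. The arbitrary initial `out` and `tmp` are what the induction needs. -/
theorem run_emitEach_big (l inp arg cnt : List Bool) (j : ℕ) : ∀ (out tmp : List Bool),
    RunWithin (.loop .big .skip (.seq (pushes .out l) (.push .tmp true)))
      (st inp out arg (List.replicate j true) cnt tmp)
      (st inp (rep l j ++ out) arg [] cnt (List.replicate j true ++ tmp))
      (j * (l.length + 3) + 1) := by
  induction j with
  | zero => intro out tmp; simpa [rep] using RunWithin.loopNil (by simp)
  | succ j ih =>
    intro out tmp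
    have h := ih (l ++ out) (true :: tmp)
    have h₁ := (run_pushes .out l (st inp out arg (List.replicate j true) cnt tmp)).seq
      (RunWithin.push (k := .tmp) true)
    simp only [update_out, st_out, update_tmp, st_tmp] at h₁
    have h₂ := RunWithin.loopCons (k := .big) (b := true) (p := .skip) (l := List.replicate j true)
      (S₁ := st inp out arg (List.replicate (j + 1) true) cnt tmp) rfl (by simpa using h₁) h
    convert h₂.mono (t₂ := (j + 1) * (l.length + 3) + 1) (by ring_nf; omega) using 2
    · rw [rep_succ', List.append_assoc]
    · rw [List.replicate_succ']; simp

theorem run_emitEach_cnt (l inp arg big : List Bool) (j : ℕ) : ∀ (out tmp : List Bool),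
    RunWithin (.loop .cnt .skip (.seq (pushes .out l) (.push .tmp true)))
      (st inp out arg big (List.replicate j true) tmp)
      (st inp (rep l j ++ out) arg big [] (List.replicate j true ++ tmp))
      (j * (l.length + 3) + 1) := by
  induction j with
  | zero => intro out tmp; simpa [rep] using RunWithin.loopNil (by simp)
  | succ j ih =>
    intro out tmp
    have h := ih (l ++ out) (true :: tmp)
    have h₁ := (run_pushes .out l (st inp out arg big (List.replicate j true) tmp)).seq
      (RunWithin.push (k := .tmp) true)
    simp only [update_out, st_out, update_tmp, st_tmp] at h₁
    have h₂ := RunWithin.loopCons (k := .cnt) (b := true) (p := .skip) (l := List.replicate j true)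
      (S₁ := st inp out arg big (List.replicate (j + 1) true) tmp) rfl (by simpa using h₁) h
    convert h₂.mono (t₂ := (j + 1) * (l.length + 3) + 1) (by ring_nf; omega) using 2
    · rw [rep_succ', List.append_assoc]
    · rw [List.replicate_succ']; simp

/-! ### Words that programs can write in polynomial time -/

theorem eval_mono (T : Polynomial ℕ) {a b : ℕ} (h : a ≤ b) : T.eval a ≤ T.eval b := by
  rw [Polynomial.eval_eq_sum, Polynomial.eval_eq_sum]
  exact Finset.sum_le_sum fun i _ => Nat.mul_le_mul_left _ (Nat.pow_le_pow_left h i)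

/-- Words depending on a number `j`, that a program can output in polynomial time when `j` is given
in unary on the stack `cnt`. -/
def CountEmits (g : ℕ → List Bool) : Prop :=
  ∃ (p : Prog) (T : Polynomial ℕ), ∀ (inp out arg big : List Bool) (j : ℕ),
    RunWithin p (st inp out arg big (List.replicate j true) [])
      (st inp (g j ++ out) arg big (List.replicate j true) []) (T.eval j)

theorem CountEmits.const (l : List Bool) : CountEmits fun _ => l :=
  ⟨pushes .out l, Polynomial.C (l.length + 1), fun inp out arg big j => by
    simpa using run_pushes .out l (st inp out arg big (List.replicate j true) [])⟩

theorem CountEmits.append {f g : ℕ → List Bool} (hf : CountEmits f) (hg : CountEmits g) :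
    CountEmits fun j => f j ++ g j := by
  obtain ⟨p, T, hp⟩ := hf
  obtain ⟨q, U, hq⟩ := hg
  -- The right factor is written first, since the output is a stack and grows at its front.
  refine ⟨.seq q p, U + T, fun inp out arg big j => ?_⟩
  have := (hq inp out arg big j).seq (hp inp (g j ++ out) arg big j)
  simpa using this

theorem CountEmits.cons {f : ℕ → List Bool} (b : Bool) (hf : CountEmits f) :
    CountEmits fun j => b :: f j :=
  (CountEmits.const [b]).append hf

theorem CountEmits.rep (l : List Bool) : CountEmits (rep l) := by
  refine ⟨emitEach .cnt l, Polynomial.X * Polynomial.C (l.length + 5) + 2,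
    fun inp out arg big j => ?_⟩
  have h₁ := run_emitEach_cnt l inp arg big j out []
  have h₂ := run_move (k := .tmp) (k' := .cnt) (by simp) (List.replicate j true)
    (st inp (StackProg.rep l j ++ out) arg big [] (List.replicate j true ++ [])) (by simp)
  refine (h₁.seq h₂).mono ?_ |> fun h => by simpa [emitEach] using h
  simp
  ring_nf
  omega

/-- Words depending on a word `w`, that a program can output in polynomial time when `w` is given
on the stack `inp`, and `M |w|` is given in unary on the stack `big`. -/
def Emits (M : Polynomial ℕ) (f : List Bool → List Bool) : Prop :=
  ∃ (p : Prog) (T : Polynomial ℕ), ∀ w out : List Bool,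
    RunWithin p (st w out [] (List.replicate (M.eval w.length) true) [] [])
      (st w (f w ++ out) [] (List.replicate (M.eval w.length) true) [] []) (T.eval w.length)

section Emits

variable {M : Polynomial ℕ}

theorem Emits.const (l : List Bool) : Emits M fun _ => l :=
  ⟨pushes .out l, Polynomial.C (l.length + 1), fun w out => by
    simpa using run_pushes .out l (st w out [] (List.replicate (M.eval w.length) true) [] [])⟩

theorem Emits.append {f g : List Bool → List Bool} (hf : Emits M f) (hg : Emits M g) :
    Emits M fun w => f w ++ g w := by
  obtain ⟨p, T, hp⟩ := hf
  obtain ⟨q, U, hq⟩ := hg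
  refine ⟨.seq q p, U + T, fun w out => ?_⟩
  have := (hq w out).seq (hp w (g w ++ out))
  simpa using this

theorem Emits.cons {f : List Bool → List Bool} (b : Bool) (hf : Emits M f) :
    Emits M fun w => b :: f w :=
  (Emits.const [b]).append hf

theorem Emits.rep (l : List Bool) : Emits M fun w => rep l (M.eval w.length) := by
  refine ⟨emitEach .big l, M * Polynomial.C (l.length + 5) + 2, fun w out => ?_⟩
  have h₁ := run_emitEach_big l w [] [] (M.eval w.length) out []
  have h₂ := run_move (k := .tmp) (k' := .big) (by simp) (List.replicate (M.eval w.length) true)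
    (st w (StackProg.rep l (M.eval w.length) ++ out) [] [] []
      (List.replicate (M.eval w.length) true ++ [])) (by simp)
  refine (h₁.seq h₂).mono ?_ |> fun h => by simpa [emitEach] using h
  simp
  ring_nf
  omega

theorem Emits.encList {α : Type} (f : α → List Bool → List Bool) (l : List α)
    (h : ∀ a ∈ l, Emits M (f a)) : Emits M fun w => TP.encList (fun a => f a w) l := by
  induction l with
  | nil => exact Emits.const _
  | cons a l ih =>
    have h₁ := ((h a (by simp)).append (ih fun b hb => h b (by simp [hb]))).cons true
    simpa [TP.encList] using h₁

/-- Concatenation, over the letters `a` of a word, of words depending on `a` and on the number of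
letters that follow `a`. -/
def suffixWords (g : Bool → ℕ → List Bool) : List Bool → List Bool
  | [] => []
  | a :: l => g a l.length ++ suffixWords g l

/-- Reversing the input onto `arg` makes its last letter come first. While letters return to `inp`,
the counter `cnt` records how many are already back, which is exactly the number of letters
following the current one. After the loop `cnt` holds the length of `w`, which is the argument of
`h`. -/
theorem Emits.suffixWords (g : Bool → ℕ → List Bool) (h : ℕ → List Bool)
    (hg : ∀ b, CountEmits (g b)) (hh : CountEmits h) :
    Emits M fun w => h w.length ++ suffixWords g w := by
  obtain ⟨p₀, T₀, h₀⟩ := hg false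
  obtain ⟨p₁, T₁, h₁⟩ := hg true
  obtain ⟨p₂, T₂, h₂⟩ := hh
  -- Invariant: `u` is the suffix already restored and output, `v` the reversed remainder, and `cnt`
  -- holds the length of `u`.
  have hloop : ∀ (v u out big : List Bool), RunWithin
      (.loop .arg (.seq p₀ (.seq (.push .cnt true) (.push .inp false)))
        (.seq p₁ (.seq (.push .cnt true) (.push .inp true))))
      (st u (StackProg.suffixWords g u ++ out) v big (List.replicate u.length true) [])
      (st (v.reverse ++ u) (StackProg.suffixWords g (v.reverse ++ u) ++ out) [] big
        (List.replicate (v.length + u.length) true) [])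
      (v.length * ((T₀ + T₁).eval (v.length + u.length) + 3) + 1) := by
    intro v
    induction v with
    | nil => intro u out big; simpa using RunWithin.loopNil (by simp)
    | cons a v ih =>
      intro u out big
      have h₃ := ih (a :: u) out big
      have h₄ : RunWithin (if a then (.seq p₁ (.seq (.push .cnt true) (.push .inp true))) else
          (.seq p₀ (.seq (.push .cnt true) (.push .inp false))))
          (st u (StackProg.suffixWords g u ++ out) v big (List.replicate u.length true) [])
          (st (a :: u) (StackProg.suffixWords g (a :: u) ++ out) v big
            (List.replicate (a :: u).length true) []) ((T₀ + T₁).eval u.length + 2) := by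
        have hp (b : Bool) : RunWithin (.seq (.push .cnt true) (.push .inp b))
            (st u (StackProg.suffixWords g (b :: u) ++ out) v big (List.replicate u.length true) [])
            (st (b :: u) (StackProg.suffixWords g (b :: u) ++ out) v big
              (List.replicate (b :: u).length true) []) 2 := by
          simpa [List.replicate_succ] using
            (RunWithin.push (k := .cnt) (S := st u (StackProg.suffixWords g (b :: u) ++ out) v big
              (List.replicate u.length true) []) true).seq (RunWithin.push (k := .inp) b)
        cases a
        · have := h₀ u (StackProg.suffixWords g u ++ out) v big u.length
          rw [← List.append_assoc] at this
          exact (this.seq (hp false)).mono (by simp)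
        · have := h₁ u (StackProg.suffixWords g u ++ out) v big u.length
          rw [← List.append_assoc] at this
          exact (this.seq (hp true)).mono (by simp)
      have h₅ := RunWithin.loopCons (S₁ := st u (StackProg.suffixWords g u ++ out) (a :: v) big
        (List.replicate u.length true) []) (k := .arg) rfl (by simpa using h₄) h₃
      have e : v.length + (a :: u).length = (a :: v).length + u.length := by simp; omega
      rw [e] at h₅
      refine (h₅.mono ?_) |> fun h => by simpa [-Polynomial.eval_add] using h
      -- Polynomials over `ℕ` are monotone, so each iteration is charged the cost at the full
      -- length.
      have := eval_mono (T₀ + T₁) (show u.length ≤ (a :: v).length + u.length by simp)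
      have hv : (a :: v).length = v.length + 1 := rfl
      rw [hv] at this ⊢
      rw [Nat.add_mul]
      have e := Polynomial.eval_add (p := T₀) (q := T₁) (x := u.length)
      omega
  refine ⟨.seq (move .inp .arg) (.seq (.loop .arg
    (.seq p₀ (.seq (.push .cnt true) (.push .inp false)))
    (.seq p₁ (.seq (.push .cnt true) (.push .inp true)))) (.seq p₂ (clear .cnt))),
    (2 * Polynomial.X + 1) + (Polynomial.X * (T₀ + T₁ + 3) + 1 + (T₂ + (2 * Polynomial.X + 1))),
    fun w out => ?_⟩
  have r₁ := run_move (k := .inp) (k' := .arg) (by simp) w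
    (st w out [] (List.replicate (M.eval w.length) true) [] []) rfl
  have r₂ := hloop w.reverse [] out (List.replicate (M.eval w.length) true)
  have r₃ := h₂ w (StackProg.suffixWords g w ++ out) [] (List.replicate (M.eval w.length) true)
    w.length
  have r₄ := run_clear (k := .cnt) (List.replicate w.length true)
    (st w (h w.length ++ (StackProg.suffixWords g w ++ out)) []
      (List.replicate (M.eval w.length) true) (List.replicate w.length true) []) rfl
  simp only [update_inp, update_arg, st_arg, List.append_nil, List.reverse_reverse,
    List.length_reverse, List.length_nil, Nat.add_zero, update_cnt, StackProg.suffixWords,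
    List.nil_append, List.length_replicate] at r₁ r₂ r₃ r₄
  have := r₁.seq (r₂.seq (r₃.seq r₄))
  rw [List.append_assoc]
  exact this.mono (by simp)

end Emits

/-! ### A unary clock of polynomial length -/

/-- The program that multiplies the number written in unary on `big` by the length, plus one, of the
word on `inp`. -/
def mulLength : Prog :=
  .seq (.loop .big .skip (.seq
    (.loop .inp (.seq (.push .arg false) (.push .cnt true))
      (.seq (.push .arg true) (.push .cnt true)))
    (.seq (move .arg .inp) (.push .cnt true))))
    (move .cnt .big)

theorem run_countLength (w : List Bool) : ∀ (out v big cnt tmp : List Bool),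
    RunWithin (.loop .inp (.seq (.push .arg false) (.push .cnt true))
        (.seq (.push .arg true) (.push .cnt true)))
      (st w out v big cnt tmp)
      (st [] out (w.reverse ++ v) big (List.replicate w.length true ++ cnt) tmp)
      (3 * w.length + 1) := by
  induction w with
  | nil => intro out v big cnt tmp; simpa using RunWithin.loopNil (by simp)
  | cons a w ih =>
    intro out v big cnt tmp
    have h₂ := ih out (a :: v) big (true :: cnt) tmp
    have h₁ : RunWithin (if a then (.seq (.push .arg true) (.push .cnt true)) else
        (.seq (.push .arg false) (.push .cnt true))) (st w out v big cnt tmp)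
        (st w out (a :: v) big (true :: cnt) tmp) 2 := by
      have h := (RunWithin.push (k := .arg) (S := st w out v big cnt tmp) a).seq
        (RunWithin.push (k := .cnt) true)
      cases a <;> simpa using h
    have h₃ := RunWithin.loopCons (k := .inp) (S₁ := st (a :: w) out v big cnt tmp) rfl
      (by simpa using h₁) h₂
    convert h₃.mono (t₂ := 3 * (a :: w).length + 1) (by simp; omega) using 2
    · simp
    · rw [List.length_cons, List.replicate_succ']; simp

/-- Each unit of `big` triggers one pass over `inp`, which adds its length to `cnt`, and one further
push, which gives the `+ 1`. The word survives through `arg`. -/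
theorem run_mulLength (w out : List Bool) (j : ℕ) :
    RunWithin mulLength (st w out [] (List.replicate j true) [] [])
      (st w out [] (List.replicate (j * (w.length + 1)) true) [] [])
      (j * (8 * w.length + 8) + 2) := by
  have h₁ : ∀ (j i : ℕ), RunWithin (.loop .big .skip (.seq
      (.loop .inp (.seq (.push .arg false) (.push .cnt true))
        (.seq (.push .arg true) (.push .cnt true)))
      (.seq (move .arg .inp) (.push .cnt true))))
      (st w out [] (List.replicate j true) (List.replicate i true) [])
      (st w out [] [] (List.replicate (j * (w.length + 1) + i) true) [])
      (j * (5 * w.length + 5) + 1) := by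
    intro j
    induction j with
    | zero => intro i; simpa using RunWithin.loopNil (by simp)
    | succ j ih =>
      intro i
      have r₁ := run_countLength w out [] (List.replicate j true) (List.replicate i true) []
      have r₂ := run_move (k := .arg) (k' := .inp) (by simp) w.reverse
        (st [] out (w.reverse ++ []) (List.replicate j true)
          (List.replicate w.length true ++ List.replicate i true) []) (by simp)
      have r₃ := ih (w.length + 1 + i)
      have r := r₁.seq (r₂.seq (RunWithin.push (k := .cnt) true))
      simp only [List.append_nil, List.length_reverse, st_inp, List.reverse_reverse, update_arg,
        update_inp, st_cnt, update_cnt, ← List.replicate_add, ← List.replicate_succ] at r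
      rw [show w.length + i + 1 = w.length + 1 + i by omega] at r
      have r' := RunWithin.loopCons (k := .big) (b := true) (p := .skip)
        (S₁ := st w out [] (List.replicate (j + 1) true) (List.replicate i true) []) rfl
        (by simpa using r) r₃
      convert r'.mono (t₂ := (j + 1) * (5 * w.length + 5) + 1) (by ring_nf; omega) using 3
      ring
  have h₂ := run_move (k := .cnt) (k' := .big) (by simp)
    (List.replicate (j * (w.length + 1)) true)
    (st w out [] [] (List.replicate (j * (w.length + 1) + 0) true) []) (by simp)
  have h := (h₁ j 0).seq h₂
  refine RunWithin.mono (t₁ := j * (5 * w.length + 5) + 1 + (2 * (j * (w.length + 1)) + 1)) ?_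
    (by ring_nf; omega)
  simpa [mulLength] using h

/-- The program that writes `c * (n + 1) ^ k` in unary on `big`, for an input of length `n`. -/
def writePower (c : ℕ) : ℕ → Prog
  | 0 => pushes .big (List.replicate c true)
  | k + 1 => .seq (writePower c k) mulLength

theorem run_writePower (c k : ℕ) : ∃ T : Polynomial ℕ, ∀ w : List Bool,
    RunWithin (writePower c k) (st w [] [] [] [] [])
      (st w [] [] (List.replicate (c * (w.length + 1) ^ k) true) [] []) (T.eval w.length) := by
  induction k with
  | zero =>
    refine ⟨Polynomial.C (c + 1), fun w => ?_⟩
    simpa [writePower] using run_pushes .big (List.replicate c true) (st w [] [] [] [] [])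
  | succ k ih =>
    obtain ⟨T, hT⟩ := ih
    refine ⟨T + (Polynomial.C c * (Polynomial.X + 1) ^ k * (8 * Polynomial.X + 8) + 2),
      fun w => ?_⟩
    have := (hT w).seq (run_mulLength w [] _)
    rw [Nat.mul_assoc, ← pow_succ] at this
    simpa [writePower] using this

/-! ### From programs to polynomial-time computability -/

/-- The stack machine that runs the program `p`. -/
noncomputable def machine (p : Prog) : FinTM2 where
  K := Stack
  kFin := Fintype.ofFinite _
  k₀ := .inp
  k₁ := .out
  Γ := fun _ => Bool
  Λ := Option p.Point
  main := some p.entry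
  ΛFin := have := p.finite_point; Fintype.ofFinite _
  σ := Option Bool
  initialState := none
  Γk₀Fin := inferInstanceAs (Fintype Bool)
  m
    | none => .load (fun _ => none) .halt
    | some x => p.code some none x

theorem machine_outputs {p : Prog} {w out : List Bool} {t : ℕ}
    (h : RunWithin p (st w [] [] [] [] []) (st [] out [] [] [] []) t) :
    Nonempty (TM2OutputsInTime (machine p) w (some out) (t + 1)) := by
  obtain ⟨s, hs, h⟩ := h
  obtain ⟨v, hv⟩ := h.sound (machine p).m some none (fun _ => rfl) none
  refine ⟨⟨⟨s + 1, ?_⟩, Nat.succ_le_succ hs⟩⟩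
  have e₁ : initList (machine p) w = ⟨some (some p.entry), none, st w [] [] [] [] []⟩ := by
    simp only [initList]
    congr 1
    funext k
    cases k <;> rfl
  have e₂ : haltList (machine p) out = ⟨none, none, st [] out [] [] [] []⟩ := by
    simp only [haltList]
    congr 1
    funext k
    cases k <;> rfl
  refine (congrArg (fun c => (flip bind (machine p).step)^[s + 1] (some c)) e₁).trans ?_
  refine Eq.trans ?_ (congrArg some e₂.symm)
  -- The one additional step executes the exit label, which resets the internal memory to its
  -- initial value, as `haltList` demands, and halts.
  exact iterate_trans hv rfl

/-- A function is computable in polynomial time, if its value on `w` can be output in polynomial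
time when `c * (|w| + 1) ^ k` is given in unary. -/
theorem Emits.polyTime {c k : ℕ} {f : List Bool → List Bool}
    (h : Emits (Polynomial.C c * (Polynomial.X + 1) ^ k) f) {β : Type} (encB : β → List Bool)
    (g : List Bool → β) (hg : ∀ w, encB (g w) = f w) :
    Nonempty (TM2ComputableInPolyTime (id : List Bool → List Bool) encB g) := by
  obtain ⟨p, T, hp⟩ := h
  obtain ⟨U, hU⟩ := run_writePower c k
  set M : Polynomial ℕ := Polynomial.C c * (Polynomial.X + 1) ^ k with hM
  have hrun : ∀ w, RunWithin (.seq (writePower c k) (.seq p (.seq (clear .inp) (clear .big))))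
      (st w [] [] [] [] []) (st [] (f w) [] [] [] [])
      ((U + (T + ((2 * Polynomial.X + 1) + (2 * M + 1)))).eval w.length) := by
    intro w
    have r₂ := hp w []
    have e : M.eval w.length = c * (w.length + 1) ^ k := by simp [hM]
    have r₃ := run_clear (k := .inp) w
      (st w (f w ++ []) [] (List.replicate (M.eval w.length) true) [] []) rfl
    have r₄ := run_clear (k := .big) (List.replicate (M.eval w.length) true)
      (st [] (f w ++ []) [] (List.replicate (M.eval w.length) true) [] []) rfl
    rw [update_inp] at r₃
    have r₁ := hU w
    rw [← e] at r₁
    have := r₁.seq (r₂.seq (r₃.seq r₄))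
    simpa only [List.append_nil, update_big, List.length_replicate, Polynomial.eval_add,
      Polynomial.eval_mul, Polynomial.eval_X, Polynomial.eval_one, Polynomial.eval_ofNat] using this
  refine ⟨{ tm := machine (.seq (writePower c k) (.seq p (.seq (clear .inp) (clear .big)))),
            inputAlphabet := Equiv.refl Bool, outputAlphabet := Equiv.refl Bool,
            time := U + (T + ((2 * Polynomial.X + 1) + (2 * M + 1))) + 1,
            outputsFun := fun w => Classical.choice ?_ }⟩
  -- The words in the goal are mapped through identity alphabet equivalences; with `u`, `v`, `t` as
  -- variables, these maps are removed by equations.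
  have h₁ : ∀ (u v : List Bool) (t : ℕ), u = w → v = f w →
      t = (U + (T + ((2 * Polynomial.X + 1) + (2 * M + 1)))).eval w.length + 1 → Nonempty
        (TM2OutputsInTime (machine (.seq (writePower c k) (.seq p (.seq (clear .inp) (clear .big)))))
          u (some v) t) := by
    rintro u _ _ rfl rfl rfl
    exact machine_outputs (hrun u)
  exact h₁ _ _ _ (List.map_id w) ((List.map_id _).trans (hg w))
    (by rw [Polynomial.eval_add, Polynomial.eval_one, id])

end StackProg

/-! ## The planning domain associated with a Turing machine and a word -/

namespace TP

/-! ### Intervals evaluated on integer differences -/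

namespace Intv

/-- The interval `]k, k + 1]`. -/
def next (k : ℕ) : Intv := ⟨k, false, some (k + 1, true), by simp⟩

/-- The interval `[k, k]`. -/
def single (k : ℕ) : Intv := ⟨k, true, some (k, true), by simp⟩

/-- The interval `[0, k + 1]`. -/
def upTo (k : ℕ) : Intv := ⟨0, true, some (k + 1, true), by simp⟩

/-- The only integer in `]k, k + 1]` is `k + 1`. This is how a non-singular interval prescribes an
exact distance. -/
theorem mem_next {a b k : ℕ} : (b : ℝ) - a ∈ (next k).toSet ↔ b = a + k + 1 := by
  simp only [toSet, next, Option.mem_def, Option.some.injEq, Set.mem_ofPred_eq, Bool.false_eq_true,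
    if_false, forall_eq', if_true, lt_sub_iff_add_lt, sub_le_iff_le_add]
  norm_cast
  omega

theorem mem_single {a b k : ℕ} : (b : ℝ) - a ∈ (single k).toSet ↔ b = a + k := by
  simp only [toSet, single, Option.mem_def, Option.some.injEq, Set.mem_ofPred_eq,
    forall_eq', if_true, le_sub_iff_add_le, sub_le_iff_le_add]
  norm_cast
  omega

theorem mem_upTo {a b k : ℕ} : (b : ℝ) - a ∈ (upTo k).toSet ↔ a ≤ b ∧ b ≤ a + k + 1 := by
  simp only [toSet, upTo, Option.mem_def, Option.some.injEq, Set.mem_ofPred_eq,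
    forall_eq', if_true, le_sub_iff_add_le, sub_le_iff_le_add]
  norm_cast
  omega

theorem mem_nonneg {a b : ℕ} : (b : ℝ) - a ∈ nonneg.toSet ↔ a ≤ b := by
  simp [toSet, nonneg]

end Intv

end TP

namespace Tiling

open Turing Complexity TP

/-- Values of the tokens: the mark that starts the initial row, the cells of the initial row, the
cells of the following rows (with the state of the machine, if the head is there), and the end. -/
inductive Val (D : Decider)
  | mark
  | inp (b : Bool)
  | blank
  | run (c : D.Γ × Option D.Λ)
  | fin

variable (D : Decider)

instance : Finite (Val D) :=
  Finite.of_surjective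
    (fun x : Option (Option (Option (Bool ⊕ D.Γ × Option D.Λ))) => match x with
      | none => Val.mark
      | some none => Val.blank
      | some (some none) => Val.fin
      | some (some (some (Sum.inl b))) => Val.inp b
      | some (some (some (Sum.inr c))) => Val.run c)
    (by
      rintro (_ | b | _ | c | _)
      exacts [⟨none, rfl⟩, ⟨some (some (some (Sum.inl b))), rfl⟩, ⟨some none, rfl⟩,
        ⟨some (some (some (Sum.inr c))), rfl⟩, ⟨some (some none), rfl⟩])

noncomputable instance : Fintype (Val D) := Fintype.ofFinite _

/-- Numbering of the values. -/
noncomputable def idx : Val D ≃ Fin (Nat.card (Val D)) := Finite.equivFin _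

variable {D}

/-- The tape cell represented by a value. -/
def cell : Val D → D.Γ × Option D.Λ
  | .inp b => (D.inputSymbol b, none)
  | .run c => c
  | _ => (default, none)

/-- The state with which the head leaves the given cell in direction `d`. -/
def leaving (d : Dir) (c : D.Γ × Option D.Λ) : Option D.Λ :=
  c.2.bind fun q => (D.M q c.1).bind fun a => match a.2 with
    | .move d' => if d = d' then some a.1 else none
    | .write _ => none

/-- The state with which the head enters a cell from the cell on its left. -/
def fromLeft : Val D → Option D.Λ
  -- The initial row carries no head. The mark acts as a left neighbour that sends the initial state
  -- into the first cell, so the head appears in its copy at time `R + 1`.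
  | .mark => some default
  | v => leaving .right (cell v)

/-- The contents of a cell after a step, if the head was there in state `q`. -/
def headCell (q : D.Λ) (s : D.Γ) : D.Γ × Option D.Λ :=
  match D.M q s with
  | none => (s, some q)
  | some (q', .write s') => (s', some q')
  | some (_, .move _) => (s, none)

/-- The contents of the cell `b` with neighbours `a` and `c` after a step. -/
def nextCell (a b c : Val D) : D.Γ × Option D.Λ :=
  match (cell b).2 with
  | some q => headCell q (cell b).1
  | none => ((cell b).1, (fromLeft a).or (leaving .left (cell c)))

/-- The machine has halted and accepted with its head on this cell. -/
def Accepting (c : D.Γ × Option D.Λ) : Prop :=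
  ∃ q ∈ D.accept, c.2 = some q ∧ D.M q c.1 = none

/-- Allowed successive values. -/
def Next : Val D → Val D → Prop
  | .mark, .inp _ | .mark, .blank | .inp _, .inp _ | .inp _, .blank | .blank, .blank
  | .blank, .run _ | .run _, .run _ => True
  | .run c, .fin => Accepting c
  | _, _ => False

open Classical in
variable (D) in
/-- The state variable. -/
noncomputable abbrev stateVar : StateVar where
  card := Nat.card (Val D)
  next i := Finset.univ.filter fun j => Next ((idx D).symm i) ((idx D).symm j)
  -- A singular interval is permitted here, because the restriction concerns only atoms of trigger
  -- rules.
  dur _ := .single 1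

variable (D) in
/-- The family of state variables, which has a single member. -/
noncomputable abbrev SV : Fin 1 → StateVar := fun _ => stateVar D

/-! ### The synchronization rules -/

/-- The quantifier `name[x = v]`. -/
noncomputable def quant (name : ℕ) (v : Val D) : Quantifier (SV D) := ⟨name, 0, idx D v⟩

/-- The existential statement saying that the next two tokens have values `b` and `c`, and that the
cell `b` has been updated one row later, i.e. `R` time units after it. -/
noncomputable def stepStatement (R : ℕ) (v b c : Val D) : ExStatement (SV D) where
  quantifiers := [quant 1 b, quant 2 c, quant 3 (.run (nextCell v b c))]
  -- The distances are 1, 2 and `R + 1` from the trigger, hence `R` from `b`. Every atom links the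
  -- trigger to a fresh name, which is what simplicity requires.
  atoms := [.interval 0 .start (.next 0) .start 1, .interval 0 .start (.next 1) .start 2,
    .interval 0 .start (.next R) .start 3]

variable (D) in
/-- The existential statement saying that the end is near. -/
noncomputable def endStatement (R : ℕ) : ExStatement (SV D) where
  quantifiers := [quant 1 .fin]
  atoms := [.interval 0 .start (.upTo R) .start 1]

/-- The trigger rule for the value `v`. -/
noncomputable def stepRule (R : ℕ) (v : Val D) : TriggerRule (SV D) where
  trigger := quant 0 v
  disjuncts := endStatement D R ::
    (Finset.univ : Finset (Val D × Val D)).toList.map fun p => stepStatement R v p.1 p.2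
  nonempty := by simp
  closed := by
    intro E hE o ho
    obtain ⟨⟨a, ha, hoa⟩, hq⟩ := ho
    by_contra hne
    simp only [List.mem_cons, List.mem_map] at hE
    change o ≠ 0 at hne
    rcases hE with rfl | ⟨p, -, rfl⟩
    · simp only [endStatement, List.mem_singleton, forall_eq, quant] at ha hq
      subst ha
      simp_all [Atom.names]
    · simp only [stepStatement, List.mem_cons, List.not_mem_nil, or_false, forall_eq_or_imp,
        forall_eq, quant] at ha hq
      rcases ha with rfl | rfl | rfl <;> simp [Atom.names] at hoa <;> omega

theorem mem_disjuncts_stepRule {R : ℕ} {v : Val D} {E : ExStatement (SV D)} :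
    E ∈ (stepRule R v).disjuncts ↔ E = endStatement D R ∨ ∃ b c, E = stepStatement R v b c := by
  simp [stepRule, eq_comm]

/-- The quantifiers for the cells of the input word and for the blank after it. The token name of a
cell is `2 ^ e`, where `e` is the distance to the blank. -/
noncomputable def inputQuants : List Bool → List (Quantifier (SV D))
  | [] => [quant 1 .blank]
  -- Powers of two serve as names because their binary code is a repeated fixed word, writable from
  -- a unary counter; a plain numbering would require binary arithmetic.
  | a :: l => quant (2 ^ (l.length + 1)) (.inp a) :: inputQuants l

/-- The tokens `2 ^ (e + 1)` and `2 ^ e` start at distance one. -/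
def linkAtom (e : ℕ) : Atom := .interval (2 ^ (e + 1)) .start (.single 1) .start (2 ^ e)

/-- The atoms that link the cells of the input word. -/
def inputAtoms : List Bool → List Atom
  | [] => []
  | _ :: l => linkAtom l.length :: inputAtoms l

variable (D) in
/-- The existential statement that fixes the beginning of the initial row. -/
noncomputable def inputStatement (w : List Bool) : ExStatement (SV D) where
  quantifiers := quant (2 ^ (w.length + 1)) .mark :: inputQuants w
  atoms := .ge 0 .start (.single 0) (2 ^ (w.length + 1)) :: linkAtom w.length :: inputAtoms w

theorem exists_mem_inputQuants (w : List Bool) {e : ℕ} (he : e ≤ w.length) :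
    ∃ q ∈ inputQuants (D := D) w, q.name = 2 ^ e := by
  induction w with
  | nil => simp_all [inputQuants, quant]
  | cons a l ih =>
    rw [List.length_cons] at he
    rcases Nat.lt_or_eq_of_le he with h | rfl
    · obtain ⟨q, hq, h⟩ := ih (by omega)
      exact ⟨q, by simp [inputQuants, hq], h⟩
    · exact ⟨_, List.mem_cons_self, rfl⟩

theorem mem_inputAtoms {w : List Bool} {a : Atom} :
    a ∈ inputAtoms w ↔ ∃ e < w.length, a = linkAtom e := by
  induction w with
  | nil => simp [inputAtoms]
  | cons b l ih =>
    simp only [inputAtoms, List.mem_cons, ih, List.length_cons, Order.lt_add_one_iff]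
    constructor
    · rintro (rfl | ⟨e, he, rfl⟩)
      · exact ⟨_, le_rfl, rfl⟩
      · exact ⟨e, he.le, rfl⟩
    · rintro ⟨e, he, rfl⟩
      rcases Nat.lt_or_eq_of_le he with h | rfl
      · exact Or.inr ⟨e, h, rfl⟩
      · exact Or.inl rfl

variable (D) in
/-- The trigger-less rule that fixes the beginning of the initial row. -/
noncomputable def inputRule (w : List Bool) : TriggerlessRule (SV D) where
  disjuncts := [inputStatement D w]
  nonempty := by simp
  closed := by
    simp only [List.mem_singleton, forall_eq]
    rintro o ⟨⟨a, ha, hoa⟩, hq⟩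
    have hq' : ∀ e ≤ w.length + 1, o ≠ 2 ^ e := by
      rintro e he rfl
      rcases Nat.lt_or_eq_of_le he with h | rfl
      · obtain ⟨q, hq₁, h⟩ := exists_mem_inputQuants (D := D) w (Nat.le_of_lt_succ h)
        exact hq q (List.mem_cons_of_mem _ hq₁) h
      · exact hq _ List.mem_cons_self rfl
    simp only [inputStatement, List.mem_cons, mem_inputAtoms] at ha
    rcases ha with rfl | rfl | ⟨e, he, rfl⟩ <;>
      simp only [linkAtom, Atom.names, List.mem_cons, List.not_mem_nil, or_false] at hoa
    · exact hq' _ le_rfl hoa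
    · rcases hoa with h | h
      · exact hq' _ le_rfl h
      · exact hq' _ (by omega) h
    · rcases hoa with h | h
      · exact hq' _ (by omega) h
      · exact hq' _ (by omega) h

variable (D) in
/-- The trigger-less rule saying that the initial row extends to time `R`. -/
noncomputable def blankRule (R : ℕ) : TriggerlessRule (SV D) where
  disjuncts := [⟨[quant 0 .blank], [.ge R .start (.single 0) 0]⟩]
  nonempty := by simp
  closed := by
    simp only [List.mem_singleton, forall_eq, ExStatement.IsFree, quant]
    rintro o ⟨h, h'⟩
    simp_all [Atom.names]

variable (D) in
/-- The trigger-less rule saying that the end is reached. -/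
noncomputable def endRule : TriggerlessRule (SV D) where
  disjuncts := [⟨[quant 0 .fin], []⟩]
  nonempty := by simp
  closed := by simp [ExStatement.IsFree]

variable (D) in
/-- The domain whose plans describe the accepting computation on `w`, for a machine that uses
fewer than about `R / 2` cells. -/
noncomputable def domain (R : ℕ) (w : List Bool) : Domain where
  n := 1
  SV := SV D
  triggerRules := (Finset.univ : Finset (Val D)).toList.map (stepRule R)
  triggerlessRules := [inputRule D w, blankRule D R, endRule D]

/-- The atoms of a trigger rule form a star centred at the trigger, and the intervals `]k, k + 1]`
and `[0, k + 1]` are not singular. The chained names and singular intervals of the input rule do no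
harm, because that rule is trigger-less. -/
theorem domain_simpleNonSingular (R : ℕ) (w : List Bool) :
    (domain D R w).SimpleNonSingular := by
  intro S hS
  obtain ⟨v, -, rfl⟩ := List.mem_map.1 hS
  constructor
  · intro E hE o ho
    change o ≠ 0 at ho
    rcases mem_disjuncts_stepRule.1 hE with rfl | ⟨b, c, rfl⟩
    · exact List.countP_le_length
    · simp only [stepStatement, List.countP_cons, Atom.isIntervalAtomOf, List.countP_nil,
        decide_eq_true_eq]
      split_ifs <;> omega
  · intro E hE a ha
    rcases mem_disjuncts_stepRule.1 hE with rfl | ⟨b, c, rfl⟩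
    · simp only [endStatement, List.mem_singleton] at ha
      subst ha
      simp [Atom.intv, Intv.IsSingular, Intv.upTo]
    · simp only [stepStatement, List.mem_cons, List.not_mem_nil, or_false] at ha
      rcases ha with rfl | rfl | rfl <;> simp [Atom.intv, Intv.IsSingular, Intv.next]

/-! ### Plans as sequences of values -/

/-- The sequences of values that correspond to the future plans. -/
structure IsTiling (R : ℕ) (w : List Bool) (u : List (Val D)) : Prop where
  chain : u.IsChain Next
  mark : u[0]? = some .mark
  input : ∀ (i : ℕ) (a : Bool), w[i]? = some a → u[i + 1]? = some (.inp a)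
  inputEnd : u[w.length + 1]? = some .blank
  rowEnd : u[R]? = some .blank
  exists_fin : ∃ i : ℕ, u[i]? = some Val.fin
  step : ∀ (t : ℕ) (v : Val D), u[t]? = some v → (∃ s ≤ R + 1, u[t + s]? = some Val.fin) ∨
    ∃ b c, u[t + 1]? = some b ∧ u[t + 2]? = some c ∧
      u[t + R + 1]? = some (.run (nextCell v b c))

/-- The values of the tokens of a timeline. -/
noncomputable def values (π : Timeline (stateVar D)) : List (Val D) :=
  π.tokens.map fun x => (idx D).symm x.1

theorem duration_eq_one (π : Timeline (stateVar D)) {x : Fin (stateVar D).card × ℝ≥0}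
    (hx : x ∈ π.tokens) : x.2 = 1 := by
  have := π.dur_mem x hx
  simp only [stateVar, Intv.toSet, Intv.single] at this
  simp at this
  exact le_antisymm this.2 this.1

/-- Unit durations identify start times with positions, which removes real numbers from the rest of
the argument. -/
theorem time_start (π : Timeline (stateVar D)) (i : Fin π.tokens.length) :
    π.time i .start = (i : ℕ) := by
  have h : (π.tokens.take i).map Prod.snd = List.replicate i 1 := by
    rw [List.eq_replicate_iff]
    constructor
    · simp [i.2.le]
    · intro d hd
      obtain ⟨x, hx, rfl⟩ := List.mem_map.1 hd
      exact duration_eq_one π (List.mem_of_mem_take hx)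
  simp [Timeline.time, h]

section Semantics

variable {Pi : MultiTimeline (SV D)}

/-- The position of the token named `o`. -/
def pos (l : Assignment Pi) (o : ℕ) : ℕ := (l o).2

theorem assignment_time (l : Assignment Pi) (o : ℕ) : l.time o .start = pos l o :=
  time_start (Pi (l o).1) (l o).2

/-- With a single state variable a token is just a position, so consistency becomes a lookup in the
sequence of values. -/
theorem consistent_iff {E : ExStatement (SV D)} {l : Assignment Pi} :
    E.Consistent l ↔
      ∀ q ∈ E.quantifiers, (values (Pi 0))[pos l q.name]? = some ((idx D).symm q.value) := by
  refine forall₂_congr fun q hq => ?_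
  obtain ⟨name, var, value⟩ := q
  obtain rfl : var = 0 := Subsingleton.elim _ _
  dsimp only [pos]
  rcases l name with ⟨x, i⟩
  obtain rfl : x = 0 := Subsingleton.elim _ _
  simp only [values, List.getElem?_map, Option.map_eq_some_iff]
  constructor
  · rintro ⟨h, e, hv⟩
    obtain rfl := eq_of_heq (Sigma.mk.inj e).2
    exact ⟨_, List.getElem?_eq_getElem i.2, congrArg _ hv⟩
  · rintro ⟨y, hy, hv⟩
    refine ⟨i, rfl, ?_⟩
    rw [List.getElem?_eq_getElem i.2, Option.some.injEq] at hy
    have := (idx D).symm.injective hv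
    rw [← hy] at this
    exact this

theorem future_sat_iff {E : ExStatement (SV D)} {l : Assignment Pi} {o : ℕ} :
    (∀ a ∈ (E.future o).atoms, a.Sat l) ↔
      (∀ a ∈ E.atoms, a.Sat l) ∧ ∀ q ∈ E.quantifiers, pos l o ≤ pos l q.name := by
  simp only [ExStatement.future, List.forall_mem_append, List.forall_mem_map, Atom.Sat,
    assignment_time, Intv.mem_nonneg]

theorem sat_next {l : Assignment Pi} {k o o' : ℕ} :
    (Atom.interval o .start (.next k) .start o').Sat l ↔ pos l o' = pos l o + k + 1 := by
  simp only [Atom.Sat, assignment_time, Intv.mem_next]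

theorem sat_upTo {l : Assignment Pi} {k o o' : ℕ} :
    (Atom.interval o .start (.upTo k) .start o').Sat l ↔
      pos l o ≤ pos l o' ∧ pos l o' ≤ pos l o + k + 1 := by
  simp only [Atom.Sat, assignment_time, Intv.mem_upTo]

theorem sat_linkAtom {l : Assignment Pi} {e : ℕ} :
    (linkAtom e).Sat l ↔ pos l (2 ^ e) = pos l (2 ^ (e + 1)) + 1 := by
  simp only [linkAtom, Atom.Sat, assignment_time, Intv.mem_single]

theorem sat_ge {l : Assignment Pi} {k o : ℕ} :
    (Atom.ge k .start (.single 0) o).Sat l ↔ pos l o = k := by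
  simp only [Atom.Sat, assignment_time, Intv.mem_single, Nat.add_zero]

end Semantics

theorem mem_inputQuants {w : List Bool} {q : Quantifier (SV D)} :
    q ∈ inputQuants w ↔
      q = quant 1 .blank ∨ ∃ i a, w[i]? = some a ∧ q = quant (2 ^ (w.length - i)) (.inp a) := by
  induction w with
  | nil => simp [inputQuants]
  | cons b l ih =>
    simp only [inputQuants, List.mem_cons, ih]
    constructor
    · rintro (rfl | rfl | ⟨i, a, h, rfl⟩)
      · exact Or.inr ⟨0, b, rfl, rfl⟩
      · exact Or.inl rfl
      · exact Or.inr ⟨i + 1, a, by simpa using h, by simp⟩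
    · rintro (rfl | ⟨_ | i, a, h, rfl⟩)
      · exact Or.inr (Or.inl rfl)
      · obtain rfl : b = a := by simpa using h
        exact Or.inl rfl
      · exact Or.inr (Or.inr ⟨i, a, by simpa using h, by simp⟩)

theorem isFuturePlan_iff {R : ℕ} {w : List Bool} {Pi : MultiTimeline (SV D)} :
    (domain D R w).IsFuturePlan Pi ↔ (∀ v, (stepRule R v).FutureSat Pi) ∧
      (inputRule D w).Sat Pi ∧ (blankRule D R).Sat Pi ∧ (endRule D).Sat Pi := by
  refine and_congr ⟨fun h v => h _ (List.mem_map.2 ⟨v, by simp, rfl⟩), fun h S hS => ?_⟩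
    ⟨fun h => ⟨h _ (.head _), h _ (.tail _ (.head _)), h _ (.tail _ (.tail _ (.head _)))⟩,
      fun h S hS => ?_⟩
  · obtain ⟨v, -, rfl⟩ := List.mem_map.1 hS
    exact h v
  · rcases List.mem_cons.1 hS with rfl | hS
    · exact h.1
    rcases List.mem_cons.1 hS with rfl | hS
    · exact h.2.1
    obtain rfl := List.mem_singleton.1 hS
    exact h.2.2

theorem futureSat_stepRule {R : ℕ} {v : Val D} {Pi : MultiTimeline (SV D)} :
    (stepRule R v).FutureSat Pi ↔ ∀ t, (values (Pi 0))[t]? = some v →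
      ∃ E ∈ (stepRule R v).disjuncts, ∃ l : Assignment Pi, E.Consistent l ∧ pos l 0 = t ∧
        (∀ a ∈ E.atoms, a.Sat l) ∧ ∀ q ∈ E.quantifiers, pos l 0 ≤ pos l q.name := by
  constructor
  · intro h t ht
    obtain ⟨x, hx, rfl⟩ : ∃ x, (Pi 0).tokens[t]? = some x ∧ (idx D).symm x.1 = v := by
      simpa [values] using ht
    obtain ⟨ht, hx'⟩ := List.getElem?_eq_some_iff.1 hx
    obtain ⟨E', hE', l, hc, hl, ha⟩ := h ⟨t, ht⟩
      ((congrArg Prod.fst hx').trans ((idx D).apply_symm_apply x.1).symm)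
    obtain ⟨E, hE, rfl⟩ := List.mem_map.1 hE'
    refine ⟨E, hE, l, hc, ?_, future_sat_iff.1 ha⟩
    exact congrArg (fun y : (x : Fin 1) × Fin (Pi x).tokens.length => (y.2 : ℕ)) hl
  · intro h i hi
    obtain ⟨E, hE, l, hc, hl, ha⟩ := h i (by
      simp only [values, List.getElem?_map, Option.map_eq_some_iff]
      refine ⟨_, List.getElem?_eq_getElem i.2, ?_⟩
      rw [Equiv.symm_apply_eq]
      exact hi)
    refine ⟨_, List.mem_map.2 ⟨E, hE, rfl⟩, l, hc, ?_, future_sat_iff.2 ha⟩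
    change ((l 0).2 : ℕ) = i at hl
    change l 0 = ⟨0, i⟩
    generalize l 0 = y at hl
    obtain ⟨x, j⟩ := y
    obtain rfl : x = 0 := Subsingleton.elim _ _
    exact congrArg _ (Fin.ext hl)

theorem isTiling_of_plan {R : ℕ} {w : List Bool} {Pi : MultiTimeline (SV D)}
    (h : (domain D R w).IsFuturePlan Pi) : IsTiling R w (values (Pi 0)) := by
  obtain ⟨hR, hI, hB, hF⟩ := isFuturePlan_iff.1 h
  obtain ⟨E, hE, l, hc, ha⟩ := hI
  obtain rfl := List.mem_singleton.1 hE
  have hcell := consistent_iff.1 hc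
  -- The mark is pinned to time 0, and each link moves one unit on while lowering the exponent of
  -- the name by one.
  have hpos : ∀ k ≤ w.length + 1, pos l (2 ^ (w.length + 1 - k)) = k := by
    intro k
    induction k with
    | zero => exact fun _ => sat_ge.1 (ha _ List.mem_cons_self)
    | succ k ih =>
      intro hk
      have hl : (linkAtom (w.length - k)).Sat l := by
        refine ha _ (List.mem_cons_of_mem _ ?_)
        rcases k with _ | k
        · exact List.mem_cons_self
        · exact List.mem_cons_of_mem _ (mem_inputAtoms.2 ⟨_, by omega, rfl⟩)
      have := sat_linkAtom.1 hl
      rw [show w.length - k + 1 = w.length + 1 - k by omega, ih (by omega)] at this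
      rw [← this]
      congr 2
      omega
  refine ⟨?_, ?_, ?_, ?_, ?_, ?_, ?_⟩
  · rw [values, List.isChain_map]
    refine (Pi 0).chain.imp fun x y hxy => ?_
    simpa using hxy
  · have := hcell _ List.mem_cons_self
    have h0 := hpos 0 (by omega)
    rw [Nat.sub_zero] at h0
    simpa [quant, h0] using this
  · intro i a hi
    have hlt : i < w.length := (List.getElem?_eq_some_iff.1 hi).1
    have := hcell _ (List.mem_cons_of_mem _ (mem_inputQuants.2 (Or.inr ⟨i, a, hi, rfl⟩)))
    have h0 := hpos (i + 1) (by omega)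
    rw [show w.length + 1 - (i + 1) = w.length - i by omega] at h0
    simpa [quant, h0] using this
  · have := hcell _ (List.mem_cons_of_mem _ (mem_inputQuants.2 (Or.inl rfl)))
    have h0 := hpos (w.length + 1) le_rfl
    rw [Nat.sub_self, pow_zero] at h0
    simpa [quant, h0] using this
  · obtain ⟨E, hE, l, hc, ha⟩ := hB
    obtain rfl := List.mem_singleton.1 hE
    have := consistent_iff.1 hc _ List.mem_cons_self
    have h0 := sat_ge.1 (ha _ List.mem_cons_self)
    simpa [quant, h0] using this
  · obtain ⟨E, hE, l, hc, ha⟩ := hF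
    obtain rfl := List.mem_singleton.1 hE
    have := consistent_iff.1 hc _ List.mem_cons_self
    exact ⟨_, by simpa [quant] using this⟩
  · intro t v htv
    obtain ⟨E, hE, l, hc, hp0, ha', -⟩ := futureSat_stepRule.1 (hR v) t htv
    have hcell := consistent_iff.1 hc
    rcases mem_disjuncts_stepRule.1 hE with rfl | ⟨b, c, rfl⟩
    · left
      have h1 := sat_upTo.1 (ha' _ List.mem_cons_self)
      have h2 := hcell _ List.mem_cons_self
      rw [hp0] at h1
      refine ⟨pos l 1 - t, by omega, ?_⟩
      rw [show t + (pos l 1 - t) = pos l 1 by omega]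
      simpa [quant] using h2
    · right
      simp only [stepStatement, List.mem_cons, List.not_mem_nil, or_false, forall_eq_or_imp,
        forall_eq, sat_next, hp0] at ha'
      simp only [stepStatement, List.mem_cons, List.not_mem_nil, or_false,
        forall_eq_or_imp, forall_eq, quant, ha'.1, ha'.2.1, ha'.2.2, Equiv.symm_apply_apply] at hcell
      exact ⟨b, c, hcell⟩

/-- The timeline with the given values. -/
noncomputable def timeline (u : List (Val D)) (hu : u ≠ []) (h : u.IsChain Next) :
    Timeline (stateVar D) where
  tokens := u.map fun v => (idx D v, 1)
  nonempty := by simpa using hu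
  dur_mem := by
    intro x hx
    obtain ⟨v, -, rfl⟩ := List.mem_map.1 hx
    simp [Intv.single, Intv.toSet]
  chain := by
    rw [List.isChain_map]
    refine h.imp fun x y hxy => ?_
    simpa using hxy

theorem values_timeline (u : List (Val D)) (hu : u ≠ []) (h : u.IsChain Next) :
    values (timeline u hu h) = u := by
  simp [values, timeline, Function.comp_def]

theorem exists_assignment {u : List (Val D)} {hu : u ≠ []} {h : u.IsChain Next} (p : ℕ → ℕ)
    (hp : ∀ o, p o < u.length) :
    ∃ l : Assignment (SV := SV D) (fun _ => timeline u hu h), ∀ o, pos l o = p o :=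
  ⟨fun o => ⟨0, ⟨p o, by simpa [timeline] using hp o⟩⟩, fun _ => rfl⟩

theorem IsTiling.isPlan {R : ℕ} {w : List Bool} {u : List (Val D)} (h : IsTiling R w u)
    (hu : u ≠ []) :
    (domain D R w).IsFuturePlan (fun _ => timeline u hu h.chain : MultiTimeline (SV D)) := by
  have hlt {i : ℕ} {v : Val D} (hi : u[i]? = some v) : i < u.length :=
    (List.getElem?_eq_some_iff.1 hi).1
  refine isFuturePlan_iff.2 ⟨fun v => futureSat_stepRule.2 fun i hi => ?_, ?_, ?_, ?_⟩
  · rw [values_timeline] at hi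
    rcases h.step i v hi with ⟨s, hs, hf⟩ | ⟨b, c, hb, hc, hr⟩
    · obtain ⟨l, hl⟩ := exists_assignment (hu := hu) (h := h.chain)
        (fun o => if o = 0 then i else i + s)
        (fun o => by split_ifs; exacts [hlt hi, hlt hf])
      refine ⟨_, mem_disjuncts_stepRule.2 (Or.inl rfl), l, consistent_iff.2 ?_, hl 0, ?_, ?_⟩
      · simpa [endStatement, quant, values_timeline, hl] using hf
      · simp [endStatement, sat_upTo, hl, Nat.add_assoc, hs]
      · simp [endStatement, quant, hl]
    -- Names 1, 2, 3 get the positions demanded by the atoms; the trigger, and every name that does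
    -- not occur, gets `i`.
    · obtain ⟨l, hl⟩ := exists_assignment (hu := hu) (h := h.chain)
        (fun o => if o = 1 then i + 1 else if o = 2 then i + 2 else
          if o = 3 then i + R + 1 else i)
        (fun o => by split_ifs; exacts [hlt hb, hlt hc, hlt hr, hlt hi])
      refine ⟨_, mem_disjuncts_stepRule.2 (Or.inr ⟨b, c, rfl⟩), l, consistent_iff.2 ?_, hl 0,
        ?_, ?_⟩
      · simpa [stepStatement, quant, values_timeline, hl] using ⟨hb, hc, hr⟩
      · simp [stepStatement, sat_next, hl]
      · simp [stepStatement, quant, hl]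
        omega
  · obtain ⟨l, hl⟩ := exists_assignment (hu := hu) (h := h.chain)
      -- The base-2 logarithm recovers the exponent of a name, that is, its distance to the blank at
      -- position `w.length + 1`.
      (fun o => w.length + 1 - Nat.log 2 o)
      (fun o => (Nat.sub_le _ _).trans_lt (hlt h.inputEnd))
    refine ⟨_, List.mem_singleton_self _, l, ?_, ?_⟩
    · refine consistent_iff.2 fun q hq => ?_
      rw [values_timeline, hl]
      rcases List.mem_cons.1 hq with rfl | hq
      · simpa [quant, Nat.log_pow] using h.mark
      · rcases mem_inputQuants.1 hq with rfl | ⟨i, a, hi, rfl⟩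
        · simpa [quant] using h.inputEnd
        · have h₁ := h.input i a hi
          have h₂ : i < w.length := (List.getElem?_eq_some_iff.1 hi).1
          simp only [quant, Nat.log_pow Nat.one_lt_two, Equiv.symm_apply_apply]
          rwa [show w.length + 1 - (w.length - i) = i + 1 by omega]
    · have hlink : ∀ e ≤ w.length, (linkAtom e).Sat l := by
        intro e he
        rw [sat_linkAtom, hl, hl, Nat.log_pow Nat.one_lt_two, Nat.log_pow Nat.one_lt_two]
        omega
      intro a ha
      simp only [inputStatement, List.mem_cons, mem_inputAtoms] at ha
      rcases ha with rfl | rfl | ⟨e, he, rfl⟩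
      · simp [sat_ge, hl, Nat.log_pow]
      · exact hlink _ le_rfl
      · exact hlink _ he.le
  · obtain ⟨l, hl⟩ := exists_assignment (hu := hu) (h := h.chain) (fun _ => R)
      (fun _ => hlt h.rowEnd)
    refine ⟨_, List.mem_singleton_self _, l, consistent_iff.2 ?_, ?_⟩
    · simpa [quant, values_timeline, hl] using h.rowEnd
    · simp [sat_ge, hl]
  · obtain ⟨i, hi⟩ := h.exists_fin
    obtain ⟨l, hl⟩ := exists_assignment (hu := hu) (h := h.chain) (fun _ => i)
      (fun _ => hlt hi)
    refine ⟨_, List.mem_singleton_self _, l, consistent_iff.2 ?_, by simp⟩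
    simpa [quant, values_timeline, hl] using hi

theorem exists_plan_iff {R : ℕ} {w : List Bool} :
    (∃ Pi : MultiTimeline (SV D), (domain D R w).IsFuturePlan Pi) ↔
      ∃ u : List (Val D), IsTiling R w u := by
  constructor
  · rintro ⟨Pi, h⟩
    exact ⟨_, isTiling_of_plan h⟩
  · rintro ⟨u, h⟩
    refine ⟨_, h.isPlan ?_⟩
    rintro rfl
    simpa using h.mark

end Tiling

/-! ## The domain can be written in polynomial time -/

namespace Tiling

open Turing Complexity TP StackProg

theorem encList_nil {α : Type} (f : α → List Bool) : encList f [] = [false] := rfl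

theorem encList_cons {α : Type} (f : α → List Bool) (a : α) (l : List α) :
    encList f (a :: l) = true :: (f a ++ encList f l) := by
  simp [encList]

theorem encList_map {α β : Type} (f : β → List Bool) (g : α → β) (l : List α) :
    encList f (l.map g) = encList (fun a => f (g a)) l := by
  simp [encList, List.flatMap_map]

theorem encNat_two_pow (j : ℕ) : encNat (2 ^ j) = rep [true, false] j ++ [true, true, false] := by
  have h : (2 ^ j).bits = List.replicate j false ++ [true] := by
    induction j with
    | zero => simp
    | succ j ih =>
      rw [pow_succ', Nat.bit0_bits _ (by positivity), ih, List.replicate_succ, List.cons_append]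
  simp [encNat, h, rep, List.flatMap, List.map_replicate]

/-- All binary digits are 1. This motivates the form `2 ^ m - 1` of the row length: it and its
successor can both be written without carrying. -/
theorem encNat_two_pow_sub_one (j : ℕ) :
    encNat (2 ^ j - 1) = rep [true, true] j ++ [false] := by
  have h : (2 ^ j - 1).bits = List.replicate j true := by
    induction j with
    | zero => simp
    | succ j ih =>
      have : 2 ^ (j + 1) - 1 = 2 * (2 ^ j - 1) + 1 := by
        have := Nat.one_le_two_pow (n := j)
        omega
      rw [this, Nat.bit1_bits, ih, List.replicate_succ]
  simp [encNat, h, rep, List.flatMap, List.map_replicate]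

theorem countEmits_encNat : CountEmits fun j => encNat (2 ^ j) := by
  simp only [encNat_two_pow]
  exact (CountEmits.rep _).append (CountEmits.const _)

theorem countEmits_encNat_succ : CountEmits fun j => encNat (2 ^ (j + 1)) := by
  simp only [encNat_two_pow, rep_succ']
  exact ((CountEmits.rep _).append (CountEmits.const _)).append (CountEmits.const _)

section Emits

variable {M : Polynomial ℕ}

theorem emits_encNat_rowLength : Emits M fun w => encNat (2 ^ M.eval w.length - 1) := by
  simp only [encNat_two_pow_sub_one]
  exact (Emits.rep _).append (Emits.const _)

theorem emits_encNat_period : Emits M fun w => encNat (2 ^ M.eval w.length - 1 + 1) := by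
  have h (j : ℕ) : 2 ^ j - 1 + 1 = 2 ^ j := Nat.sub_add_cancel Nat.one_le_two_pow
  simp only [h, encNat_two_pow]
  exact (Emits.rep _).append (Emits.const _)

theorem emits_next : Emits M fun w => (Intv.next (2 ^ M.eval w.length - 1)).encode := by
  have h (k : ℕ) : (Intv.next k).encode =
    encNat k ++ false :: true :: (encNat (k + 1) ++ [true]) := rfl
  simp only [h]
  exact emits_encNat_rowLength.append (((emits_encNat_period.append (Emits.const _)).cons true).cons _)

theorem emits_upTo : Emits M fun w => (Intv.upTo (2 ^ M.eval w.length - 1)).encode := by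
  have h (k : ℕ) : (Intv.upTo k).encode =
    encNat 0 ++ true :: true :: (encNat (k + 1) ++ [true]) := rfl
  simp only [h]
  exact (Emits.const _).append (((emits_encNat_period.append (Emits.const _)).cons true).cons _)

variable (D : Decider)

/-- For a fixed machine, only the interval endpoints depend on `w`; everything else, including the
finite list of guesses `(b, c)`, is a constant word. -/
theorem emits_stepRule (v : Val D) :
    Emits M fun w => (stepRule (2 ^ M.eval w.length - 1) v).encode := by
  simp only [TriggerRule.encode, stepRule, encList_cons, encList_map]
  refine (Emits.const _).append (Emits.cons _ (Emits.append ?_ (Emits.encList _ _ fun p _ => ?_)))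
  · simp only [endStatement, ExStatement.encode, Atom.encode, encList_cons, encList_nil]
    repeat' first
      | with_reducible exact Emits.const _
      | with_reducible exact emits_upTo
      | with_reducible apply Emits.cons
      | with_reducible apply Emits.append
  · simp only [stepStatement, ExStatement.encode, Atom.encode, encList_cons, encList_nil]
    repeat' first
      | with_reducible exact Emits.const _
      | with_reducible exact emits_next
      | with_reducible apply Emits.cons
      | with_reducible apply Emits.append

theorem encList_inputQuants (w : List Bool) :
    encList Quantifier.encode (inputQuants (D := D) w) =
      suffixWords (fun a j => true :: (quant (D := D) (2 ^ (j + 1)) (.inp a)).encode) w ++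
        encList Quantifier.encode [quant (D := D) 1 .blank] := by
  induction w with
  | nil => rfl
  | cons a l ih => simp [inputQuants, encList_cons, suffixWords, ih]

theorem encList_inputAtoms (w : List Bool) :
    encList Atom.encode (inputAtoms w) =
      suffixWords (fun _ j => true :: (linkAtom j).encode) w ++ [false] := by
  induction w with
  | nil => rfl
  | cons a l ih => simp [inputAtoms, encList_cons, suffixWords, ih]

theorem countEmits_quant (v : Val D) :
    CountEmits fun j => true :: (quant (D := D) (2 ^ (j + 1)) v).encode := by
  simp only [Quantifier.encode, quant]
  exact (countEmits_encNat_succ.append (CountEmits.const _)).cons _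

theorem countEmits_linkAtom : CountEmits fun j => true :: (linkAtom j).encode := by
  simp only [linkAtom, Atom.encode]
  exact ((countEmits_encNat_succ.append ((CountEmits.const _).append ((CountEmits.const _).append
      ((CountEmits.const _).append countEmits_encNat)))).cons _).cons _

theorem countEmits_firstAtoms : CountEmits fun j =>
    (true :: (Atom.ge 0 .start (.single 0) (2 ^ (j + 1))).encode) ++
      (true :: (linkAtom j).encode) := by
  refine CountEmits.append (CountEmits.cons _ ?_) countEmits_linkAtom
  simp only [Atom.encode]
  exact (((CountEmits.const _).append
    ((CountEmits.const _).append ((CountEmits.const _).append countEmits_encNat_succ))).cons _).cons _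

/-- The quantifier of the mark and the first two atoms depend only on the length of `w`, and the
remaining entries only on a letter and the number of letters after it. Both lists thus have the
shape handled by `Emits.suffixWords`. -/
theorem emits_inputStatement : Emits M fun w => (inputStatement D w).encode := by
  have h (w : List Bool) : (inputStatement D w).encode =
      (((true :: (quant (D := D) (2 ^ (w.length + 1)) .mark).encode) ++
        suffixWords (fun a j => true :: (quant (D := D) (2 ^ (j + 1)) (.inp a)).encode) w) ++
        encList Quantifier.encode [quant (D := D) 1 .blank]) ++
      ((((true :: (Atom.ge 0 .start (.single 0) (2 ^ (w.length + 1))).encode) ++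
        (true :: (linkAtom w.length).encode)) ++
        suffixWords (fun _ j => true :: (linkAtom j).encode) w) ++ [false]) := by
    simp only [inputStatement, ExStatement.encode, encList_cons, encList_inputQuants,
      encList_inputAtoms, List.append_assoc, List.cons_append]
  simp only [h]
  refine Emits.append (Emits.append ?_ (Emits.const _)) (Emits.append ?_ (Emits.const _))
  · exact Emits.suffixWords _ (fun j => true :: (quant (D := D) (2 ^ (j + 1)) .mark).encode)
      (fun b => countEmits_quant D _) (countEmits_quant D _)
  · exact Emits.suffixWords _ _ (fun _ => countEmits_linkAtom) countEmits_firstAtoms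

theorem emits_domain : Emits M fun w => (domain D (2 ^ M.eval w.length - 1) w).encode := by
  have h (R : ℕ) (w : List Bool) : (domain D R w).encode =
      encList StateVar.encode (List.ofFn (SV D)) ++
        (encList (fun v => (stepRule R v).encode) (Finset.univ : Finset (Val D)).toList ++
          encList TriggerlessRule.encode [inputRule D w, blankRule D R, endRule D]) := by
    rw [← encList_map TriggerRule.encode (stepRule R)]
    rfl
  simp only [h]
  refine (Emits.const _).append (Emits.append ?_ ?_)
  · exact Emits.encList _ _ fun v _ => emits_stepRule D v
  · simp only [encList_cons, encList_nil]
    refine Emits.cons _ (Emits.append ?_ (Emits.cons _ (Emits.append ?_ (Emits.const _))))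
    · simp only [inputRule, TriggerlessRule.encode, encList_cons, encList_nil]
      exact Emits.cons _ ((emits_inputStatement D).append (Emits.const _))
    · simp only [blankRule, TriggerlessRule.encode, ExStatement.encode, Atom.encode, encList_cons,
        encList_nil]
      repeat' first
        | with_reducible exact Emits.const _
        | with_reducible exact emits_encNat_rowLength
        | with_reducible apply Emits.cons
        | with_reducible apply Emits.append

end Emits

end Tiling

/-! ## Correctness of the reduction -/

namespace Tiling

open Turing Complexity TP

variable {D : Decider}

/-! ### The run of the machine and its local update rule -/

/-- A step of the machine, where halted configurations do not change. -/
def totalStep (D : Decider) (c : TM0.Cfg D.Γ D.Λ × ℤ) : TM0.Cfg D.Γ D.Λ × ℤ :=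
  (trackedStep D.M c).getD c

/-- The configuration after `j` steps on the input `w`. -/
def conf (D : Decider) (w : List Bool) (j : ℕ) : TM0.Cfg D.Γ D.Λ × ℤ :=
  (totalStep D)^[j] (D.start w)

theorem conf_succ (w : List Bool) (j : ℕ) : conf D w (j + 1) = totalStep D (conf D w j) :=
  Function.iterate_succ_apply' _ _ _

theorem reaches_conf (w : List Bool) (j : ℕ) :
    StateTransition.Reaches (trackedStep D.M) (D.start w) (conf D w j) := by
  induction j with
  | zero => exact .refl
  | succ j ih =>
    rw [conf_succ, totalStep]
    rcases h : trackedStep D.M (conf D w j) with _ | c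
    · exact ih
    · exact ih.tail h

theorem exists_conf_eq {w : List Bool} {c : TM0.Cfg D.Γ D.Λ × ℤ}
    (h : StateTransition.Reaches (trackedStep D.M) (D.start w) c) : ∃ j, conf D w j = c := by
  induction h with
  | refl => exact ⟨0, rfl⟩
  | tail _ hbc ih =>
    obtain ⟨j, rfl⟩ := ih
    refine ⟨j + 1, ?_⟩
    rw [conf_succ, totalStep, Option.mem_def.1 hbc, Option.getD_some]

/-- By determinism, of two reachable configurations one reaches the other, and a halted one reaches
only itself. -/
theorem eq_of_halted {c c' : TM0.Cfg D.Γ D.Λ × ℤ} {w : List Bool}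
    (h : StateTransition.Reaches (trackedStep D.M) (D.start w) c) (hc : trackedStep D.M c = none)
    (h' : StateTransition.Reaches (trackedStep D.M) (D.start w) c')
    (hc' : trackedStep D.M c' = none) : c = c' := by
  have aux {a b : TM0.Cfg D.Γ D.Λ × ℤ} (ha : trackedStep D.M a = none)
      (hab : StateTransition.Reaches (trackedStep D.M) a b) : a = b := by
    rcases Relation.ReflTransGen.cases_head hab with h | ⟨d, hd, -⟩
    · exact h
    · rw [ha] at hd; cases hd
  rcases StateTransition.reaches_total h h' with h | h
  · exact aux hc h
  · exact (aux hc' h).symm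

theorem trackedStep_eq_none {c : TM0.Cfg D.Γ D.Λ × ℤ} :
    trackedStep D.M c = none ↔ D.M c.1.q c.1.Tape.head = none := by
  obtain ⟨⟨q, T⟩, x⟩ := c
  rcases h : D.M q T.head with _ | a <;> simp [trackedStep, TM0.step, h]

theorem totalStep_of_none {q : D.Λ} {T : Tape D.Γ} {x : ℤ} (h : D.M q T.head = none) :
    totalStep D (⟨q, T⟩, x) = (⟨q, T⟩, x) := by
  simp [totalStep, trackedStep, h]

theorem totalStep_of_write {q q' : D.Λ} {s : D.Γ} {T : Tape D.Γ} {x : ℤ}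
    (h : D.M q T.head = some (q', .write s)) :
    totalStep D (⟨q, T⟩, x) = (⟨q', T.write s⟩, x) := by
  simp [totalStep, trackedStep, TM0.step, h, headShift]

theorem totalStep_of_move {q q' : D.Λ} {d : Dir} {T : Tape D.Γ} {x : ℤ}
    (h : D.M q T.head = some (q', .move d)) :
    totalStep D (⟨q, T⟩, x) = (⟨q', T.move d⟩, x + headShift (.move d : TM0.Stmt D.Γ)) := by
  simp [totalStep, trackedStep, TM0.step, h]

/-- The tape cell at position `i` of a configuration, with the state if the head is there. -/
def cellAt (c : TM0.Cfg D.Γ D.Λ × ℤ) (i : ℤ) : D.Γ × Option D.Λ :=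
  (c.1.Tape.nth (i - c.2), if i = c.2 then some c.1.q else none)

/-- Locality of the machine: a cell under the head is rewritten, and any other cell keeps its symbol
and acquires a state only from a neighbour whose head moves towards it. -/
theorem cellAt_totalStep (c : TM0.Cfg D.Γ D.Λ × ℤ) (i : ℤ) :
    cellAt (totalStep D c) i = match (cellAt c i).2 with
      | some q => headCell q (cellAt c i).1
      | none => ((cellAt c i).1,
          (leaving .right (cellAt c (i - 1))).or (leaving .left (cellAt c (i + 1)))) := by
  obtain ⟨⟨q, T⟩, x⟩ := c
  -- Everything is expressed through the offset `i - x` from the head; the cases are then offset 0,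
  -- 1, -1 and all others.
  have e₁ : (i - 1 = x) = (i - x = 1) := by rw [eq_iff_iff]; omega
  have e₂ : (i + 1 = x) = (i - x = -1) := by rw [eq_iff_iff]; omega
  have e₃ : (i = x) = (i - x = 0) := by rw [eq_iff_iff]; omega
  have e₄ : i - 1 - x = (i - x) - 1 := by omega
  have e₅ : i + 1 - x = (i - x) + 1 := by omega
  rcases h : D.M q T.head with _ | ⟨q', _ | s⟩
  · rw [totalStep_of_none h]
    simp only [cellAt, e₁, e₂, e₃, e₄, e₅]
    generalize i - x = k
    by_cases h0 : k = 0
    · subst h0; simp [headCell, h]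
    · by_cases h1 : k = 1
      · subst h1; simp [leaving, h]
      · by_cases h2 : k = -1
        · subst h2; simp [leaving, h]
        · simp [leaving, h0, h1, h2]
  · rename_i d
    rw [totalStep_of_move h]
    cases d
    · have e₆ : (i = x + headShift (.move .left : TM0.Stmt D.Γ)) = (i - x = -1) := by
        rw [eq_iff_iff, headShift]; omega
      have e₇ : i - (x + headShift (.move .left : TM0.Stmt D.Γ)) = i - x + 1 := by
        rw [headShift]; omega
      simp only [cellAt, e₁, e₂, e₃, e₄, e₅, e₆, e₇, Tape.move_left_nth, add_sub_cancel_right]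
      generalize i - x = k
      by_cases h0 : k = 0
      · subst h0; simp [headCell, h]
      · by_cases h1 : k = 1
        · subst h1; simp [leaving, h]
        · by_cases h2 : k = -1
          · subst h2; simp [leaving, h]
          · simp [leaving, h0, h1, h2]
    · have e₆ : (i = x + headShift (.move .right : TM0.Stmt D.Γ)) = (i - x = 1) := by
        rw [eq_iff_iff, headShift]; omega
      have e₇ : i - (x + headShift (.move .right : TM0.Stmt D.Γ)) = i - x - 1 := by
        rw [headShift]; omega
      simp only [cellAt, e₁, e₂, e₃, e₄, e₅, e₆, e₇, Tape.move_right_nth, sub_add_cancel]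
      generalize i - x = k
      by_cases h0 : k = 0
      · subst h0; simp [headCell, h]
      · by_cases h1 : k = 1
        · subst h1; simp [leaving, h]
        · by_cases h2 : k = -1
          · subst h2; simp [leaving, h]
          · simp [leaving, h0, h1, h2]
  · rw [totalStep_of_write h]
    simp only [cellAt, e₁, e₂, e₃, e₄, e₅, Tape.write_nth]
    generalize i - x = k
    by_cases h0 : k = 0
    · subst h0; simp [headCell, h]
    · by_cases h1 : k = 1
      · subst h1; simp [leaving, h]
      · by_cases h2 : k = -1
        · subst h2; simp [leaving, h]
        · simp [leaving, h0, h1, h2]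

/-! ### Positions of the head -/

theorem conf_snd_step (w : List Bool) (j : ℕ) :
    |(conf D w (j + 1)).2 - (conf D w j).2| ≤ 1 := by
  rw [conf_succ]
  generalize conf D w j = c
  obtain ⟨⟨q, T⟩, x⟩ := c
  rcases h : D.M q T.head with _ | ⟨q', _ | s⟩
  · rw [totalStep_of_none h]; simp
  · rename_i d
    rw [totalStep_of_move h]
    cases d <;> simp [headShift]
  · rw [totalStep_of_write h]; simp

/-- A discrete intermediate value argument: the head starts at 0 and moves by at most one cell per
step. -/
theorem uIcc_subset_visitedCells (w : List Bool) (j : ℕ) :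
    Set.uIcc 0 (conf D w j).2 ⊆ D.visitedCells w := by
  have hv (j : ℕ) : (conf D w j).2 ∈ D.visitedCells w := ⟨_, reaches_conf w j, rfl⟩
  induction j with
  | zero =>
    intro i hi
    have h0 : (conf D w 0).2 = 0 := rfl
    rw [h0, Set.uIcc_self, Set.mem_singleton_iff] at hi
    rw [hi, ← h0]
    exact hv 0
  | succ j ih =>
    intro i hi
    by_cases h : i = (conf D w (j + 1)).2
    · rw [h]; exact hv _
    · apply ih
      have := abs_le.1 (conf_snd_step (D := D) w j)
      rw [Set.mem_uIcc] at hi ⊢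
      omega

/-- All cells between 0 and the head have been visited, and there is one more of them than the
absolute value of the head position. A bound on the number of cells thus becomes a bound on
positions. -/
theorem abs_conf_snd_lt {w : List Bool} {S : ℕ}
    (hS : (D.visitedCells w).encard ≤ (S : ℕ∞)) (j : ℕ) : |(conf D w j).2| < S := by
  have h := (Set.encard_le_encard (uIcc_subset_visitedCells (D := D) w j)).trans hS
  rw [← Finset.coe_uIcc, Set.encard_coe_eq_coe_finsetCard, Int.card_uIcc, Nat.cast_le] at h
  have := Int.natCast_natAbs ((conf D w j).2)
  omega

end Tiling

namespace Tiling

open Turing Complexity TP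

variable {D : Decider}

/-! ### The sequence that describes the computation -/

/-- The contents of the cell at time `t`, when successive configurations are written one after the
other, on `R` cells each, starting from the one at position `-S` at time `R + 1 - S`. -/
def traceCell (D : Decider) (R S : ℕ) (w : List Bool) (t : ℕ) : D.Γ × Option D.Λ :=
  cellAt (conf D w ((t - (R + 1 - S)) / R)) (((t - (R + 1 - S)) % R : ℕ) - S)

/-- The value at time `t` of the sequence that describes the computation on `w`. -/
def trace (D : Decider) (R S : ℕ) (w : List Bool) (t : ℕ) : Val D :=
  if t = 0 then .mark
  else if t ≤ R then (w[t - 1]?).elim .blank .inp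
  else .run (traceCell D R S w t)

theorem traceCell_eq {R S : ℕ} (w : List Bool) (j : ℕ) {k : ℕ} (hk : k < R) :
    traceCell D R S w (j * R + k + (R + 1 - S)) = cellAt (conf D w j) (k - S) := by
  have hR : 0 < R := by omega
  rw [traceCell, Nat.add_sub_cancel, Nat.add_comm (j * R), Nat.add_mul_div_right _ _ hR,
    Nat.add_mul_mod_self_right, Nat.div_eq_of_lt hk, Nat.mod_eq_of_lt hk, Nat.zero_add]

theorem exists_time {R S : ℕ} (hR : 0 < R) {t : ℕ} (ht : R + 1 - S ≤ t) :
    ∃ j k, k < R ∧ t = j * R + k + (R + 1 - S) := by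
  refine ⟨(t - (R + 1 - S)) / R, (t - (R + 1 - S)) % R, Nat.mod_lt _ hR, ?_⟩
  rw [Nat.div_add_mod']
  omega

theorem init_nth_nat (w : List Bool) (i : ℕ) :
    (D.start w).1.Tape.nth i = (cell ((w[i]?).elim Val.blank Val.inp : Val D)).1 := by
  change (Tape.mk' _ (ListBlank.mk _)).nth i = _
  rw [Tape.mk'_nth_nat, ListBlank.nth_mk, List.getI_eq_getElem?_getD, List.getElem?_map]
  cases w[i]? <;> rfl

theorem init_nth_neg (w : List Bool) {i : ℤ} (hi : i < 0) :
    (D.start w).1.Tape.nth i = default := by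
  obtain ⟨n, rfl⟩ := Int.eq_negSucc_of_lt_zero hi
  change (Tape.mk' (ListBlank.mk ([] : List D.Γ))
    (ListBlank.mk (w.map D.inputSymbol))).left.nth n = _
  rw [Tape.mk'_left, ListBlank.nth_mk]
  rfl

theorem cellAt_conf_zero (w : List Bool) (i : ℤ) :
    cellAt (conf D w 0) i = ((D.start w).1.Tape.nth i, if i = 0 then some default else none) := by
  have h : (conf D w 0).2 = 0 := rfl
  simp only [cellAt, h, sub_zero]
  rfl

theorem leaving_eq_none (d : Dir) {c : D.Γ × Option D.Λ} (h : c.2 = none) :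
    leaving d c = none := by
  rw [leaving, h, Option.bind_none]

theorem cell_elim_snd (o : Option Bool) : (cell (o.elim Val.blank Val.inp : Val D)).2 = none := by
  cases o <;> rfl

section Trace

variable {R S : ℕ} {w : List Bool}

theorem cell_trace_snd {t : ℕ} (ht : t ≤ R) : (cell (trace D R S w t)).2 = none := by
  rw [trace]
  split_ifs
  · rfl
  · exact cell_elim_snd _

theorem fromLeft_trace {t : ℕ} (ht : t ≠ 0) :
    fromLeft (trace D R S w t) = leaving .right (cell (trace D R S w t)) := by
  rw [trace, if_neg ht]
  split_ifs
  · cases w[t - 1]? <;> rfl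
  · rfl

/-- The last `S` times of the initial row also stand for positions `-S` to `-1` of the first
configuration. The two readings agree: both give headless blanks, as the input ends earlier. -/
theorem cell_trace (hS : 1 ≤ S) (hR : 2 * S + w.length + 3 ≤ R) {t : ℕ} (ht : R + 1 - S ≤ t) :
    cell (trace D R S w t) = traceCell D R S w t := by
  rw [trace, if_neg (by omega)]
  split_ifs with h
  · rw [List.getElem?_eq_none (by omega)]
    obtain ⟨k, rfl⟩ : ∃ k, t = 0 * R + k + (R + 1 - S) := ⟨t - (R + 1 - S), by omega⟩
    rw [traceCell_eq w 0 (by omega), cellAt_conf_zero, init_nth_neg w (by omega),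
      if_neg (by omega)]
    rfl
  · rfl

theorem cellAt_snd_eq_none {j : ℕ} (hpos : |(conf D w j).2| < S) {i : ℤ}
    (hi : i ≤ -S ∨ S ≤ i) :
    (cellAt (conf D w j) i).2 = none := by
  rw [cellAt, if_neg]
  rintro rfl
  have := abs_lt.1 hpos
  omega

/-- Before time `R + 1 - S` the rule copies the initial row and creates the head next to the mark.
From there on it is the local update rule of the machine, once the row edges are seen to carry no
head. -/
theorem trace_step (hS : 1 ≤ S) (hR : 2 * S + w.length + 3 ≤ R)
    (hpos : ∀ j, |(conf D w j).2| < S) (t : ℕ) :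
    trace D R S w (t + R + 1) =
      .run (nextCell (trace D R S w t) (trace D R S w (t + 1)) (trace D R S w (t + 2))) := by
  rw [trace, if_neg (by omega), if_neg (by omega)]
  congr 1
  rcases Nat.lt_or_ge (t + 1) (R + 1 - S) with hlt | hge
  · have e : t + R + 1 = 0 * R + (t + S) + (R + 1 - S) := by omega
    have h₁ : trace D R S w (t + 1) = (w[t]?).elim .blank .inp := by
      rw [trace, if_neg (by omega), if_pos (by omega), Nat.add_sub_cancel]
    have h₂ : leaving .left (cell (trace D R S w (t + 2))) = none :=
      leaving_eq_none _ (cell_trace_snd (by omega))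
    rw [e, traceCell_eq w 0 (by omega), nextCell, h₂, cell_trace_snd (by omega), h₁,
      cellAt_conf_zero, show ((t + S : ℕ) : ℤ) - S = (t : ℕ) by omega, init_nth_nat]
    refine Prod.ext rfl ?_
    rcases t with _ | t
    · rw [if_pos (by omega)]
      rfl
    · rw [if_neg (by omega), fromLeft_trace (by omega),
        leaving_eq_none _ (cell_trace_snd (by omega))]
      rfl
  · obtain ⟨j, k, hk, e⟩ := exists_time (by omega) hge
    have e' : t + R + 1 = (j + 1) * R + k + (R + 1 - S) := by rw [Nat.succ_mul]; omega
    have h₁ : cell (trace D R S w (t + 1)) = cellAt (conf D w j) (k - S) := by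
      rw [cell_trace hS hR hge, e, traceCell_eq w j hk]
    have h₀ : fromLeft (trace D R S w t) = leaving .right (cellAt (conf D w j) (k - S - 1)) := by
      rw [fromLeft_trace (by omega)]
      -- At position `-S` the token on the left is not position `-S - 1` but the last cell of the
      -- previous row, or of the initial row when `j = 0`. Neither holds the head, so both send
      -- nothing.
      rcases k with _ | k
      · rw [leaving_eq_none _ (cellAt_snd_eq_none (hpos j) (by omega))]
        apply leaving_eq_none
        rcases j with _ | j
        · exact cell_trace_snd (by omega)
        · obtain rfl : t = j * R + (R - 1) + (R + 1 - S) := by rw [Nat.succ_mul] at e; omega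
          rw [cell_trace hS hR (by omega), traceCell_eq w j (by omega)]
          exact cellAt_snd_eq_none (hpos j) (by omega)
      · obtain rfl : t = j * R + k + (R + 1 - S) := by omega
        rw [cell_trace hS hR (by omega), traceCell_eq w j (by omega)]
        congr 2
        omega
    have h₂ : leaving .left (cell (trace D R S w (t + 2))) =
        leaving .left (cellAt (conf D w j) (k - S + 1)) := by
      rw [cell_trace hS hR (by omega)]
      -- Symmetrically, after the last cell of a row comes position `-S` of the next configuration
      -- instead of position `R - S`; both are headless.
      rcases Nat.lt_or_ge (k + 1) R with hk' | hk'
      · rw [show t + 2 = j * R + (k + 1) + (R + 1 - S) by omega, traceCell_eq w j hk']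
        congr 2
        omega
      · rw [show t + 2 = (j + 1) * R + 0 + (R + 1 - S) by rw [Nat.succ_mul]; omega,
          traceCell_eq w (j + 1) (by omega),
          leaving_eq_none _ (cellAt_snd_eq_none (hpos _) (by omega)),
          leaving_eq_none _ (cellAt_snd_eq_none (hpos _) (by omega))]
    rw [e', traceCell_eq w (j + 1) hk, conf_succ, cellAt_totalStep, ← h₀, ← h₁, ← h₂]
    rfl

theorem next_trace (hR : w.length + 1 ≤ R) (t : ℕ) :
    Next (trace D R S w t) (trace D R S w (t + 1)) := by
  simp only [trace, Nat.add_sub_cancel, Nat.add_one_ne_zero, if_false]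
  rcases t with _ | t
  · rw [if_pos rfl, if_pos (by omega)]
    cases w[0]? <;> trivial
  · rw [if_neg (by omega), Nat.add_sub_cancel]
    rcases Nat.lt_or_ge R (t + 1) with h | h
    · rw [if_neg (by omega), if_neg (by omega)]
      trivial
    · rw [if_pos h]
      rcases Nat.lt_or_ge R (t + 1 + 1) with h' | h'
      · rw [if_neg (by omega), List.getElem?_eq_none (by omega)]
        trivial
      · rw [if_pos h']
        rcases Nat.lt_or_ge (t + 1) w.length with h'' | h''
        · rw [List.getElem?_eq_getElem h'', List.getElem?_eq_getElem (by omega)]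
          trivial
        · rw [List.getElem?_eq_none h'']
          cases w[t]? <;> trivial

end Trace

/-! ### Tilings and accepting computations -/

theorem getElem?_chain {u : List (Val D)} (h : u.IsChain Next) {i : ℕ} {v v' : Val D}
    (hv : u[i]? = some v) (hv' : u[i + 1]? = some v') : Next v v' := by
  obtain ⟨h₁, rfl⟩ := List.getElem?_eq_some_iff.1 hv
  obtain ⟨h₂, rfl⟩ := List.getElem?_eq_some_iff.1 hv'
  exact List.isChain_iff_getElem.1 h i h₂

theorem getElem?_of_le {u : List (Val D)} {i j : ℕ} {v : Val D} (hv : u[j]? = some v)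
    (hij : i ≤ j) : ∃ v', u[i]? = some v' :=
  ⟨_, List.getElem?_eq_getElem (hij.trans_lt (List.getElem?_eq_some_iff.1 hv).1)⟩

theorem le_of_fin {u : List (Val D)} (h : u.IsChain Next) {i j : ℕ} {v : Val D}
    (hi : u[i]? = some .fin) (hj : u[j]? = some v) : j ≤ i := by
  by_contra hlt
  obtain ⟨v', hv'⟩ := getElem?_of_le hj (show i + 1 ≤ j by omega)
  have := getElem?_chain h hi hv'
  cases v' <;> exact this

/-- The values that may follow the initial row. -/
def Late : Val D → Prop
  | .run _ | .fin => True
  | _ => False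

/-- Once the configurations begin, no blank of the initial row can return. Hence a blank at time `R`
forces the initial row to last at least until then. -/
theorem late_of_le {u : List (Val D)} (h : u.IsChain Next) {i : ℕ} {v : Val D}
    (hi : u[i]? = some v) (hv : Late v) : ∀ {j : ℕ} {v' : Val D}, i ≤ j → u[j]? = some v' →
      Late v' := by
  intro j v' hij
  induction j, hij using Nat.le_induction generalizing v' with
  | base => intro hj; rw [hi] at hj; cases hj; exact hv
  | succ j hij ih =>
    intro hj
    obtain ⟨x, hx⟩ := getElem?_of_le hj (Nat.le_succ j)
    have h₁ := ih hx
    have h₂ := getElem?_chain h hx hj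
    cases x <;> cases v' <;> trivial

/-- A tiling has no freedom: the trigger-less rules fix times 0 to `R`, and each later value is
determined by the step rule from three earlier ones. -/
theorem IsTiling.eq_trace {R S : ℕ} {w : List Bool} {u : List (Val D)} (h : IsTiling R w u)
    (hS : 1 ≤ S) (hR : 2 * S + w.length + 3 ≤ R) (hpos : ∀ j, |(conf D w j).2| < S) :
    ∀ (t : ℕ) (v : Val D), u[t]? = some v → v ≠ .fin → v = trace D R S w t := by
  have hblank : ∀ t, w.length + 1 ≤ t → t ≤ R → u[t]? = some Val.blank := by
    intro t ht
    induction t, ht using Nat.le_induction with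
    | base => exact fun _ => h.inputEnd
    | succ t ht ih =>
      intro htR
      obtain ⟨v, hv⟩ := getElem?_of_le h.rowEnd htR
      have h₁ := getElem?_chain h.chain (ih (by omega)) hv
      cases v with
      | blank => exact hv
      | run c => exact (late_of_le h.chain hv trivial htR h.rowEnd).elim
      | _ => exact h₁.elim
  intro t
  induction t using Nat.strong_induction_on with
  | _ t ih =>
  intro v hv hfin
  rcases Nat.lt_or_ge R t with ht | ht
  · obtain ⟨s, rfl⟩ : ∃ s, t = s + R + 1 := ⟨t - R - 1, by omega⟩
    obtain ⟨x, hx⟩ := getElem?_of_le hv (show s ≤ s + R + 1 by omega)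
    have hne {i : ℕ} {y : Val D} (hi : i < s + R + 1) (hy : u[i]? = some y) : y ≠ .fin := by
      rintro rfl
      have := le_of_fin h.chain hy hv
      omega
    -- Nothing follows the end token, so the alternative that releases the rule would place it at or
    -- before `t`, where the value is by assumption not the end.
    rcases h.step s x hx with ⟨i, hi, hf⟩ | ⟨b, c, hb, hc, hr⟩
    · rcases Nat.lt_or_ge i (R + 1) with hi' | hi'
      · exact (hne (by omega) hf rfl).elim
      · obtain rfl : i = R + 1 := by omega
        rw [← Nat.add_assoc, hv] at hf
        exact (hfin (Option.some.inj hf)).elim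
    · rw [hr] at hv
      rw [← Option.some.inj hv, trace_step hS hR hpos,
        ih s (by omega) x hx (hne (by omega) hx),
        ih (s + 1) (by omega) b hb (hne (by omega) hb),
        ih (s + 2) (by omega) c hc (hne (by omega) hc)]
  · rw [trace]
    rcases t with _ | t
    · rw [h.mark] at hv
      exact (Option.some.inj hv).symm
    · rw [if_neg (by omega), if_pos ht, Nat.add_sub_cancel]
      rcases Nat.lt_or_ge t w.length with ht' | ht'
      · have h₁ := List.getElem?_eq_getElem ht'
        have := h.input t _ h₁
        rw [hv] at this
        rw [h₁]
        exact Option.some.inj this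
      · have := hblank (t + 1) (by omega) ht
        rw [hv] at this
        rw [List.getElem?_eq_none ht']
        exact Option.some.inj this

theorem exists_tiling_iff {L : Set (List Bool)} (hD : D.Decides L) {R S : ℕ} {w : List Bool}
    (hS : 1 ≤ S) (hR : 2 * S + w.length + 3 ≤ R)
    (hcells : (D.visitedCells w).encard ≤ (S : ℕ∞)) :
    (∃ u : List (Val D), IsTiling R w u) ↔ w ∈ L := by
  have hpos := abs_conf_snd_lt hcells
  obtain ⟨c, hc, hhalt, hacc⟩ := hD w
  constructor
  · rintro ⟨u, h⟩
    obtain ⟨i, hi⟩ := h.exists_fin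
    rcases i with _ | i
    · rw [h.mark] at hi
      cases hi
    obtain ⟨v, hv⟩ := getElem?_of_le hi (Nat.le_succ i)
    have hnext := getElem?_chain h.chain hv hi
    obtain ⟨x, rfl⟩ : ∃ x, v = .run x := by
      cases v with
      | run x => exact ⟨x, rfl⟩
      | _ => exact hnext.elim
    have htrace := h.eq_trace hS hR hpos i _ hv (by simp)
    obtain ⟨q, hq, hx, hM⟩ : Accepting x := hnext
    have hx' : x = traceCell D R S w i := by
      rw [trace] at htrace
      split_ifs at htrace
      · generalize w[i - 1]? = o at htrace
        cases o <;> cases htrace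
      · exact Val.run.inj htrace
    rw [traceCell] at hx'
    generalize (i - (R + 1 - S)) / R = j at hx'
    generalize (((i - (R + 1 - S)) % R : ℕ) - S : ℤ) = p at hx'
    subst hx'
    rw [cellAt] at hx
    dsimp only at hx
    -- A cell carries a state only if the head is there, so the accepting cell shows the true state
    -- and scanned symbol of configuration `j`.
    split_ifs at hx with hp
    rw [cellAt, hp, sub_self, Tape.nth_zero] at hM
    have hq' := Option.some.inj hx
    rw [← hq'] at hM hq
    have := eq_of_halted hc hhalt (reaches_conf w j) (trackedStep_eq_none.2 hM)
    rw [← hacc, this]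
    exact hq
  · intro hw
    obtain ⟨j, rfl⟩ := exists_conf_eq hc
    -- The halted configuration is read one row later, so that its head cell certainly lies after
    -- time `R`, wherever the head is.
    have hj : conf D w (j + 1) = conf D w j := by
      rw [conf_succ, totalStep, hhalt, Option.getD_none]
    have hlt := abs_lt.1 (hpos j)
    obtain ⟨k, hk⟩ : ∃ k : ℕ, (k : ℤ) = (conf D w j).2 + S :=
      ⟨((conf D w j).2 + S).toNat, by omega⟩
    set y := (j + 1) * R + k + (R + 1 - S) with hy
    have hRy : R < y := by rw [hy, Nat.succ_mul]; omega
    have hlast : Next (trace D R S w y) .fin := by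
      rw [trace, if_neg (by omega), if_neg (by omega), hy, traceCell_eq w (j + 1) (by omega), hj,
        show (k : ℤ) - S = (conf D w j).2 by omega]
      refine ⟨(conf D w j).1.q, hacc.2 hw, by simp [cellAt], ?_⟩
      rw [cellAt, sub_self, Tape.nth_zero]
      exact trackedStep_eq_none.1 hhalt
    have hu : ∀ t ≤ y, ((List.range (y + 1)).map (trace D R S w) ++ [Val.fin])[t]? =
        some (trace D R S w t) := by
      intro t ht
      rw [List.getElem?_append_left (by simp; omega)]
      simp [Nat.lt_succ_of_le ht]
    have hu' : ((List.range (y + 1)).map (trace D R S w) ++ [Val.fin])[y + 1]? =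
        some Val.fin := by
      rw [List.getElem?_append_right (by simp)]
      simp
    refine ⟨(List.range (y + 1)).map (trace D R S w) ++ [Val.fin], ?_, ?_, ?_, ?_, ?_,
      ⟨_, hu'⟩, ?_⟩
    · rw [List.isChain_iff_getElem]
      intro i hi
      have hi' : i ≤ y := by simp at hi; omega
      have h₁ := hu i hi'
      rw [List.getElem?_eq_getElem (by omega), Option.some.injEq] at h₁
      rw [h₁]
      rcases Nat.lt_or_eq_of_le hi' with h | rfl
      · have h₂ := hu (i + 1) h
        rw [List.getElem?_eq_getElem hi, Option.some.injEq] at h₂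
        rw [h₂]
        exact next_trace (by omega) i
      · rw [List.getElem?_eq_getElem hi, Option.some.injEq] at hu'
        rw [hu']
        exact hlast
    · rw [hu 0 (by omega)]
      rfl
    · intro i a hi
      have hi' : i < w.length := (List.getElem?_eq_some_iff.1 hi).1
      rw [hu _ (by omega), trace, if_neg (by omega), if_pos (by omega), Nat.add_sub_cancel, hi]
      rfl
    · rw [hu _ (by omega), trace, if_neg (by omega), if_pos (by omega), Nat.add_sub_cancel,
        List.getElem?_eq_none le_rfl]
      rfl
    · rw [hu _ (by omega), trace, if_neg (by omega), if_pos le_rfl,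
        List.getElem?_eq_none (by omega)]
      rfl
    · intro t v hv
      have ht : t ≤ y + 1 := by
        have := (List.getElem?_eq_some_iff.1 hv).1
        simp at this
        omega
      -- If the target of the rule lies beyond `y`, then the end at `y + 1` is at most `R + 1` units
      -- after `t`, which is just what the release alternative allows.
      rcases Nat.lt_or_ge y (t + R + 1) with h | h
      · left
        refine ⟨y + 1 - t, by omega, ?_⟩
        rw [show t + (y + 1 - t) = y + 1 by omega]
        exact hu'
      · right
        rw [hu t (by omega)] at hv
        rw [← Option.some.inj hv]
        exact ⟨_, _, hu _ (by omega), hu _ (by omega),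
          by rw [hu _ h, trace_step hS hR hpos]⟩

/-! ### The reduction -/

/-- It lets the clock have the form `c * (n + 1) ^ k`, which stack programs can write by repeated
multiplication. -/
theorem exists_eval_le (p : Polynomial ℕ) : ∃ c k : ℕ, ∀ n, p.eval n ≤ c * (n + 1) ^ k := by
  induction p using Polynomial.induction_on' with
  | add p q hp hq =>
    obtain ⟨c, k, h⟩ := hp
    obtain ⟨c', k', h'⟩ := hq
    refine ⟨c + c', k + k', fun n => ?_⟩
    rw [Polynomial.eval_add, Nat.add_mul]
    refine Nat.add_le_add ((h n).trans (Nat.mul_le_mul_left _ ?_))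
      ((h' n).trans (Nat.mul_le_mul_left _ ?_)) <;>
    exact Nat.pow_le_pow_right (Nat.succ_pos n) (by omega)
  | monomial k c =>
    refine ⟨c, k, fun n => ?_⟩
    rw [Polynomial.eval_monomial]
    exact Nat.mul_le_mul_left _ (Nat.pow_le_pow_left (Nat.le_succ n) _)

theorem row_bound (a n m : ℕ) (h : a + n + 4 ≤ m) : 2 * 2 ^ a + n + 3 ≤ 2 ^ m - 1 := by
  have h₁ : 2 ^ (a + n + 4) ≤ 2 ^ m := Nat.pow_le_pow_right (by norm_num) h
  have h₂ : 2 ^ (a + n + 4) = 2 ^ a * 2 ^ n * 16 := by rw [pow_add, pow_add]; norm_num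
  have h₃ : n < 2 ^ n := Nat.lt_two_pow_self
  have h₄ : 1 ≤ 2 ^ a := Nat.one_le_two_pow
  have h₅ : 1 ≤ 2 ^ n := Nat.one_le_two_pow
  have h₆ : 2 ^ a ≤ 2 ^ a * 2 ^ n := Nat.le_mul_of_pos_right _ h₅
  have h₇ : 2 ^ n ≤ 2 ^ a * 2 ^ n := Nat.le_mul_of_pos_left _ h₄
  omega

end Tiling

/-- The future TP problem with simple trigger rules and non-singular intervals (in the atoms of the
trigger rules) is `EXPSPACE`-hard under polynomial-time reductions. -/
theorem mainTheorem3 :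
    Complexity.EXPSPACEHard
      (fun P : {P : TP.Domain // P.SimpleNonSingular} => P.1.encode)
      {P | ∃ Pi : TP.MultiTimeline P.1.SV, P.1.IsFuturePlan Pi} := by
  rintro L ⟨D, p, hD, hcells⟩
  -- The summand `X + 4` is slack: it makes a row of `2 ^ M(n) - 1` cells hold both sides of the
  -- tape and the input, with `S = 2 ^ p(n)`.
  obtain ⟨c, k, hck⟩ := Tiling.exists_eval_le (p + Polynomial.X + 4)
  set M : Polynomial ℕ := Polynomial.C c * (Polynomial.X + 1) ^ k with hM
  have hMp (n : ℕ) : p.eval n + n + 4 ≤ M.eval n := by simpa [hM] using hck n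
  refine ⟨fun w => ⟨Tiling.domain D (2 ^ M.eval w.length - 1) w,
    Tiling.domain_simpleNonSingular _ _⟩,
    (Tiling.emits_domain D (M := M)).polyTime _ _ fun w => rfl, fun w => ?_⟩
  refine ((Tiling.exists_tiling_iff hD (S := 2 ^ p.eval w.length) Nat.one_le_two_pow
    (Tiling.row_bound _ _ _ (hMp w.length)) (hcells w)).symm.trans ?_)
  exact Tiling.exists_plan_iff.symm
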